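/- Let $(M,J)$ be a smooth almost complex manifold of real dimension $4$. Let $\Lambda_J^-$ be the bundle of real $2$-forms $\beta$ with $\beta(JX,JY)=-\beta(X,Y)$, with the complex structure $(J\beta)(X,Y)=-\beta(JX,Y)$. Its fibres are oriented by the bases $(\beta,-J\beta)$. Let $D\subset\mathbb C$ be the open unit disk and $u:D\to M$ a smooth embedded $J$-holomorphic disk (smooth, $du\circ i=J\circ du$, an immersion and a homeomorphism onto its image). Let $\alpha$ be a smooth closed $2$-form on $M$ that is a section of $\Lambda_J^-$. (i) There are an open neighbourhood $U$ of $u(0)$ in $M$ and a nowhere vanishing section $\phi$ of $\Lambda_J^-$ over $U$, continuous on $U$ and smooth on $U\setminus\{u(0)\}$, such that $\{\phi,J\phi\}$ is a frame of $\Lambda_J^-$ over $U$ and $$\alpha=f\,\phi+g\,J\phi\quad\text{on }U$$ with real functions $f,g$ that are continuous on $U$ and smooth on $U\setminus\{u(0)\}$, and $f\circ u-i\,(g\circ u)$ is holomorphic on $u^{-1}(U)$. (ii) Either $\alpha_{u(z)}=0$ for all $z\in D$, or the zeros of $z\mapsto\alpha_{u(z)}$ have no accumulation point in $D$, and at each zero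 $z_0\in D$ the local intersection number of the section $\alpha\circ u$ of $\Lambda_J^-$ with the zero section is positive. (If $\alpha=a\psi+b\,J\psi$ with a continuous local frame $\{\psi,J\psi\}$ of $\Lambda_J^-$ near $u(z_0)$, this number is the winding number around $0$ of $(a-ib)\circ u$ along small positively oriented circles centred at $z_0$. It does not depend on the frame.) -/

import Mathlib

open Set Filter Topology Manifold ContDiff

/-- The model space of a 4-manifold. -/
abbrev E4 : Type := EuclideanSpace ℝ (Fin 4)

/-- A (not necessarily continuous) field of alternating 2-forms on the tangent spaces of a
4-manifold: a set-theoretic section of `Λ²T*M`. -/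
abbrev TwoForm (M : Type*) [TopologicalSpace M] [ChartedSpace E4 M] : Type _ :=
  ∀ x : M, (TangentSpace (𝓡 4) x) [⋀^Fin 2]→L[ℝ] ℝ

/-- The set of coordinates, in the chart at `c`, of the points of `U` lying in that chart. -/
def chartDomain {M : Type*} [TopologicalSpace M] [ChartedSpace E4 M] (c : M) (U : Set M) : Set E4 :=
  (extChartAt (𝓡 4) c).target ∩ (extChartAt (𝓡 4) c).symm ⁻¹' U

namespace TwoForm

variable {M : Type*} [TopologicalSpace M] [ChartedSpace E4 M]

/-- The coordinate expression of a 2-form in the chart at `c`, that is, its pullback under the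
inverse of the chart. It is meaningful on the target of the chart. -/
noncomputable def inChart (α : TwoForm M) (c : M) : E4 → E4 [⋀^Fin 2]→L[ℝ] ℝ := fun y =>
  (α ((extChartAt (𝓡 4) c).symm y)).compContinuousLinearMap
    (mfderiv 𝓘(ℝ, E4) (𝓡 4) (extChartAt (𝓡 4) c).symm y)

/-- Continuity on an open set: all coordinate expressions are continuous. -/
def IsContinuousOn (α : TwoForm M) (U : Set M) : Prop :=
  ∀ c : M, ContinuousOn (α.inChart c) (chartDomain c U)

/-- Smoothness on an open set: all coordinate expressions are smooth. -/
def IsSmoothOn (α : TwoForm M) (U : Set M) : Prop :=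
  ∀ c : M, ContDiffOn ℝ ∞ (α.inChart c) (chartDomain c U)

/-- `dα = 0`: the exterior derivative of every coordinate expression vanishes. -/
def IsClosedForm (α : TwoForm M) : Prop :=
  ∀ c : M, ∀ y ∈ (extChartAt (𝓡 4) c).target, extDeriv (α.inChart c) y = 0

end TwoForm

/-- A smooth almost complex structure on a 4-manifold: a smooth bundle endomorphism `J` of the
tangent bundle with `J² = -1`. -/
structure AlmostComplexStructure (M : Type*) [TopologicalSpace M] [ChartedSpace E4 M]
    [IsManifold (𝓡 4) ∞ M] where
  toFun : ∀ x : M, TangentSpace (𝓡 4) x →L[ℝ] TangentSpace (𝓡 4) x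
  sq : ∀ (x : M) (v : TangentSpace (𝓡 4) x), toFun x (toFun x v) = -v
  smooth : ContMDiff (𝓡 4) ((𝓡 4).prod 𝓘(ℝ, E4 →L[ℝ] E4)) ∞
    (fun x => Bundle.TotalSpace.mk' (E4 →L[ℝ] E4)
      (E := fun x : M => TangentSpace (𝓡 4) x →L[ℝ] TangentSpace (𝓡 4) x) x (toFun x))

namespace AlmostComplexStructure

variable {M : Type*} [TopologicalSpace M] [ChartedSpace E4 M] [IsManifold (𝓡 4) ∞ M]

/-- The fibre at `x` of the bundle `Λ_J⁻`: the 2-forms with `β(JX, JY) = -β(X, Y)`. -/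
def antiInvariant (J : AlmostComplexStructure M) (x : M) :
    Submodule ℝ ((TangentSpace (𝓡 4) x) [⋀^Fin 2]→L[ℝ] ℝ) where
  carrier := {β | ∀ v w : TangentSpace (𝓡 4) x,
    β ![J.toFun x v, J.toFun x w] = -β ![v, w]}
  add_mem' {a b} ha hb v w := by
    have h1 := ha v w
    have h2 := hb v w
    simp only [ContinuousAlternatingMap.add_apply, h1, h2]
    ring
  zero_mem' v w := by simp
  smul_mem' c a ha v w := by
    have h1 := ha v w
    simp [h1]

/-- The complex structure of `Λ_J⁻`, `(Jβ)(X, Y) = -β(JX, Y)` (see `act_apply`). The right-hand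
side is alternating only for `β` in `Λ_J⁻`; the expression
`-½ β((1 + J)X, (1 + J)Y)` used here is always alternating and agrees with it on `Λ_J⁻`. -/
noncomputable def act (J : AlmostComplexStructure M) {x : M}
    (β : (TangentSpace (𝓡 4) x) [⋀^Fin 2]→L[ℝ] ℝ) : (TangentSpace (𝓡 4) x) [⋀^Fin 2]→L[ℝ] ℝ :=
  (-(1 / 2) : ℝ) •
    β.compContinuousLinearMap (ContinuousLinearMap.id ℝ (TangentSpace (𝓡 4) x) + J.toFun x)

theorem act_apply (J : AlmostComplexStructure M) {x : M}
    {β : (TangentSpace (𝓡 4) x) [⋀^Fin 2]→L[ℝ] ℝ} (hβ : β ∈ J.antiInvariant x)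
    (v w : TangentSpace (𝓡 4) x) : J.act β ![v, w] = -β ![J.toFun x v, w] := by
  have hadd : ∀ a b c : TangentSpace (𝓡 4) x, β ![a + b, c] = β ![a, c] + β ![b, c] :=
    fun a b c => β.toContinuousMultilinearMap.cons_add ![c] a b
  have hneg : ∀ a c : TangentSpace (𝓡 4) x, β ![-a, c] = -β ![a, c] := fun a c => by
    have := β.toContinuousMultilinearMap.cons_smul ![c] (-1) a
    simpa using this
  have hswap : ∀ a b : TangentSpace (𝓡 4) x, β ![a, b] = -β ![b, a] := fun a b => by
    have := β.toAlternatingMap.map_swap ![b, a] (i := 0) (j := 1) (by decide)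
    have h2 : (![b, a] ∘ Equiv.swap (0 : Fin 2) 1) = ![a, b] := by
      ext i; fin_cases i <;> simp
    rw [h2] at this
    exact this
  have hcomp : J.act β ![v, w] = -(1 / 2) * β ![v + J.toFun x v, w + J.toFun x w] := by
    have : (⇑(ContinuousLinearMap.id ℝ (TangentSpace (𝓡 4) x) + J.toFun x) ∘ ![v, w]) =
        ![v + J.toFun x v, w + J.toFun x w] := by
      ext i; fin_cases i <;> simp
    simp only [act, ContinuousAlternatingMap.smul_apply,
      ContinuousAlternatingMap.compContinuousLinearMap_apply, this, smul_eq_mul]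
  have h1 := hβ v w
  have h2 := hβ (J.toFun x v) w
  rw [J.sq, hneg] at h2
  have e1 := hadd v (J.toFun x v) (w + J.toFun x w)
  have e2 := hswap v (w + J.toFun x w)
  have e3 := hswap (J.toFun x v) (w + J.toFun x w)
  rw [hadd] at e2 e3
  have e4 := hswap w v
  have e5 := hswap (J.toFun x w) v
  have e6 := hswap w (J.toFun x v)
  have e7 := hswap (J.toFun x w) (J.toFun x v)
  rw [hcomp]
  linarith

/-- `{φ, Jφ}` is a frame of `Λ_J⁻` over `U`; in particular `φ` is nowhere zero on `U`. -/
def IsFrameOn (J : AlmostComplexStructure M) (φ : TwoForm M) (U : Set M) : Prop :=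
  ∀ x ∈ U, LinearIndependent ℝ ![φ x, J.act (φ x)] ∧
    Submodule.span ℝ {φ x, J.act (φ x)} = J.antiInvariant x

/-- The open unit disk. -/
def disk : Set ℂ := Metric.ball 0 1

/-- `u` restricts to a smooth embedded `J`-holomorphic disk: on the open unit disk it is smooth,
`du ∘ i = J ∘ du`, it is an immersion, and it is a homeomorphism onto its image. (The values of
`u` off the open disk are irrelevant.) -/
structure IsEmbeddedHolomorphicDisk (J : AlmostComplexStructure M) (u : ℂ → M) : Prop where
  smooth : ContMDiffOn 𝓘(ℝ, ℂ) (𝓡 4) ∞ u disk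
  holomorphic : ∀ z ∈ disk, ∀ v : ℂ, mfderiv 𝓘(ℝ, ℂ) (𝓡 4) u z (Complex.I * v : ℂ) =
    J.toFun (u z) (mfderiv 𝓘(ℝ, ℂ) (𝓡 4) u z v)
  immersion : ∀ z ∈ disk, Function.Injective (mfderiv 𝓘(ℝ, ℂ) (𝓡 4) u z)
  embedding : IsEmbedding (disk.domRestrict u)

end AlmostComplexStructure

/-- The loop `γ : [0, 2π] → ℂ ∖ {0}` has winding number `k` around `0`: it has a continuous
argument, which increases by `2πk`. -/
def HasWindingNumber (γ : ℝ → ℂ) (k : ℤ) : Prop :=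
  ∃ Θ : ℝ → ℝ, ContinuousOn Θ (Icc 0 (2 * Real.pi)) ∧
    (∀ θ ∈ Icc 0 (2 * Real.pi),
      γ θ ≠ 0 ∧ γ θ = (‖γ θ‖ : ℂ) * Complex.exp (Complex.I * (Θ θ : ℂ))) ∧
    Θ (2 * Real.pi) - Θ 0 = 2 * Real.pi * k

/-- The section `α ∘ u` of `Λ_J⁻` over the disk has at `z` an isolated zero (or no zero) of
local intersection number `k` with the zero section. In a local frame `{ψ, Jψ}` write
`α = a ψ + b Jψ`. The form `ψ + i Jψ` is of type `(2, 0)` and `α = Re ((a - i b) (ψ + i Jψ))`, so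
`a - i b` is the complex fibre coordinate (the fibre is oriented by `(ψ, -Jψ)`), and the local
intersection number is the winding number of `(a - i b) ∘ u` along small circles around `z`. Two
frames differ by a continuous nowhere zero complex function near `u z`, so the number does not
depend on the frame. -/
def HasZeroIndex {M : Type*} [TopologicalSpace M] [ChartedSpace E4 M] [IsManifold (𝓡 4) ∞ M]
    (J : AlmostComplexStructure M) (α : TwoForm M) (u : ℂ → M) (z : ℂ) (k : ℤ) : Prop :=
  ∃ (V : Set M) (ψ : TwoForm M) (a b : M → ℝ), IsOpen V ∧ u z ∈ V ∧
    ψ.IsContinuousOn V ∧ J.IsFrameOn ψ V ∧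
    (∀ x ∈ V, α x = a x • ψ x + b x • J.act (ψ x)) ∧
    ∀ᶠ r : ℝ in 𝓝[>] 0, HasWindingNumber
      (fun θ => (a (u (circleMap z r θ)) : ℂ) - Complex.I * (b (u (circleMap z r θ)) : ℂ)) k

/-! The bundle of anti-invariant forms is a complex line bundle, so locally `α` is one complex
function times a frame. The point is that along a `J`-holomorphic curve this function satisfies a
Cauchy-Riemann inequality. With `u_y = J u_x` and a suitable constant vector `b`, put `k = α(u_x, b)
- i α(u_y, b)`. Anti-invariance writes the real and imaginary parts of `k_x + i k_y` as `∂_y α(u_x,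
w) - ∂_x α(u_y, w)` with `w = Jb` and `w = b` respectively. Closedness replaces the derivatives of
`α` along the curve by `(∂_w α)(u_x, J u_x)`, and differentiating the identity `α(X, JX) = 0` turns
this into `-α(u_x, (∂_w J) u_x)`. No derivative of `α` is left, so `|k_x + i k_y| ≤ C |k|` locally
(`contraction_deriv`, `dbar_curveCoord_le`).

The similarity principle `exists_exp_mul_holomorphic` now gives `k = exp(s) σ` with `s` continuous
and `σ` holomorphic. Near a point, the zeros of `α ∘ u` are those of `σ`, hence isolated unless `σ`
vanishes identically there. At an isolated zero the winding number is the order of `σ`, because the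
continuous nonvanishing factor contributes nothing. Connectedness of the disk makes the alternative
global, which is (ii).

For (i), let `q` be the coefficient of `α` in a smooth frame generated by `η`. Then `q ∘ u = F σ`
with `F` continuous and nowhere zero. If `σ` is not identically zero near the centre, `F = (q ∘ u) /
σ` is smooth off the centre. It extends to a function `Φ` on the ambient space (`exists_extension`),
and in the frame generated by `Φ η` the coefficient is `q / Φ`, which restricts to `σ` on the curve.
At the centre only continuity of `F` is available, which is why the frame is only continuous there.
-/

/-! ### The Cauchy-Pompeiu formula at the origin -/

section CauchyTransform
open MeasureTheory

/-- Twice the Cauchy-Riemann operator `∂/∂z̄`. -/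
noncomputable def dbar (f : ℂ → ℂ) (z : ℂ) : ℂ :=
  fderiv ℝ f z 1 + Complex.I * fderiv ℝ f z Complex.I

theorem Complex.locallyIntegrable_inv : LocallyIntegrable (fun z : ℂ => z⁻¹) := by
  intro z
  refine ⟨Metric.ball 0 (‖z‖ + 1), Metric.isOpen_ball.mem_nhds (by simp), ?_⟩
  refine integrableOn_ball_of_norm_le_rpow (C := 1) (α := 1) (by simp) (by simp) ?_
    measurable_inv.aestronglyMeasurable
  refine Eventually.of_forall fun x => ?_
  simp [Real.rpow_neg_one, norm_inv]

theorem integrableOn_polar_of_continuous {A : ℝ × ℝ → ℂ} (hA : Continuous A) {R : ℝ}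
    (hR : ∀ p, R < p.1 → A p = 0) :
    IntegrableOn A (Ioi (0 : ℝ) ×ˢ Ioo (-Real.pi) Real.pi) := by
  have h1 : IntegrableOn A (Icc 0 R ×ˢ Icc (-Real.pi) Real.pi) :=
    hA.continuousOn.integrableOn_compact (isCompact_Icc.prod isCompact_Icc)
  refine h1.of_forall_sdiff_eq_zero (measurableSet_Ioi.prod measurableSet_Ioo) ?_
  rintro ⟨r, θ⟩ ⟨⟨h1, h2⟩, h3⟩
  refine hR _ (lt_of_not_ge fun h4 => h3 ⟨⟨le_of_lt h1, h4⟩, Ioo_subset_Icc_self h2⟩)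

/-- In polar coordinates the integrand times the Jacobian is the radial derivative of `G` plus `i/r`
times its angular derivative. The radial part integrates to `-G 0` on every ray by compact support;
the angular part integrates to zero on every circle by periodicity. -/
theorem integral_inv_mul_dbar {G : ℂ → ℂ} (hG : ContDiff ℝ 1 G) (hs : HasCompactSupport G) :
    ∫ z, z⁻¹ * dbar G z = -(2 * Real.pi) * G 0 := by
  obtain ⟨R, hR⟩ : ∃ R : ℝ, ∀ z, R < ‖z‖ → z ∉ tsupport G := by
    obtain ⟨R, hR⟩ := hs.isCompact.isBounded.exists_norm_le
    exact ⟨R, fun z hz h => absurd (hR z h) (not_le.2 hz)⟩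
  have hG0 : ∀ z, R < ‖z‖ → G z = 0 := fun z hz => image_eq_zero_of_notMem_tsupport (hR z hz)
  have hD0 : ∀ z, R < ‖z‖ → fderiv ℝ G z = 0 := fun z hz =>
    image_eq_zero_of_notMem_tsupport fun h => hR z hz (tsupport_fderiv_subset ℝ h)
  have hDc : Continuous (fderiv ℝ G) := hG.continuous_fderiv one_ne_zero
  set e : ℝ → ℂ := fun θ => Complex.exp (θ * Complex.I) with he
  have hec : Continuous e := by fun_prop
  have hen : ∀ θ, ‖e θ‖ = 1 := fun θ => by simp [he, Complex.norm_exp_ofReal_mul_I]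
  have he0 : ∀ θ, e θ ≠ 0 := fun θ => Complex.exp_ne_zero _
  set A : ℝ × ℝ → ℂ := fun p => fderiv ℝ G (p.1 * e p.2) (e p.2) with hA
  set B : ℝ × ℝ → ℂ := fun p => fderiv ℝ G (p.1 * e p.2) (Complex.I * e p.2) with hB
  have hp : Continuous fun p : ℝ × ℝ => (p.1 : ℂ) * e p.2 := by fun_prop
  have hAc : Continuous A := (hDc.comp hp).clm_apply (by fun_prop)
  have hBc : Continuous B := (hDc.comp hp).clm_apply (by fun_prop)
  have hnorm : ∀ p : ℝ × ℝ, R < p.1 → R < ‖(p.1 : ℂ) * e p.2‖ := fun p hp => by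
    rw [norm_mul, hen, mul_one, Complex.norm_real, Real.norm_eq_abs]
    exact hp.trans_le (le_abs_self _)
  have hA0 : ∀ p, R < p.1 → A p = 0 := fun p hp => by simp [hA, hD0 _ (hnorm p hp)]
  have hB0 : ∀ p, R < p.1 → B p = 0 := fun p hp => by simp [hB, hD0 _ (hnorm p hp)]
  have hAi := integrableOn_polar_of_continuous hAc hA0
  have hBi := integrableOn_polar_of_continuous hBc hB0
  have hder : ∀ (r θ : ℝ), HasDerivAt (fun r : ℝ => G (r * e θ)) (A (r, θ)) r := fun r θ => by
    have h1 : HasDerivAt (fun r : ℝ => (r : ℂ) * e θ) (e θ) r := by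
      simpa using (Complex.ofRealCLM.hasDerivAt (x := r)).mul_const (e θ)
    exact ((hG.differentiable one_ne_zero _).hasFDerivAt).comp_hasDerivAt r h1
  have hder2 : ∀ (r θ : ℝ), HasDerivAt (fun θ : ℝ => G (r * e θ)) (r * B (r, θ)) θ := fun r θ => by
    have h1 : HasDerivAt (fun θ : ℝ => (r : ℂ) * e θ) (r • (Complex.I * e θ)) θ := by
      have h2 : HasDerivAt (fun θ : ℝ => (θ : ℂ) * Complex.I) Complex.I θ := by
        simpa using (Complex.ofRealCLM.hasDerivAt (x := θ)).mul_const Complex.I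
      have h3 := (h2.cexp).const_mul (r : ℂ)
      refine h3.congr_deriv ?_
      rw [Complex.real_smul, mul_comm Complex.I]
    have h4 := ((hG.differentiable one_ne_zero _).hasFDerivAt).comp_hasDerivAt θ h1
    rw [map_smul] at h4
    exact h4.congr_deriv (Complex.real_smul)
  have hIA : ∫ p in Ioi (0 : ℝ) ×ˢ Ioo (-Real.pi) Real.pi, A p = -(2 * Real.pi) * G 0 := by
    rw [Measure.volume_eq_prod, ← setIntegral_prod_swap, setIntegral_prod _ (by
      rw [← Measure.volume_eq_prod]; exact hAi.swap)]
    have : ∀ θ : ℝ, ∫ r in Ioi (0 : ℝ), A (r, θ) = - G 0 := fun θ => by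
      have h := integral_Ioi_of_hasDerivAt_of_tendsto (a := 0) (f := fun r : ℝ => G (r * e θ))
        (f' := fun r => A (r, θ)) (m := 0)
        (hder 0 θ).continuousAt.continuousWithinAt (fun r _ => hder r θ) ?_ ?_
      · simpa using h
      · have h1 : IntegrableOn (fun r => A (r, θ)) (Icc 0 R) :=
          (hAc.comp (by fun_prop : Continuous fun r : ℝ => (r, θ))).continuousOn.integrableOn_compact
            isCompact_Icc
        refine h1.of_forall_sdiff_eq_zero measurableSet_Ioi ?_
        rintro r ⟨h1, h3⟩
        exact hA0 _ (lt_of_not_ge fun h4 => h3 ⟨le_of_lt h1, h4⟩)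
      · refine tendsto_const_nhds.congr' ?_
        filter_upwards [eventually_gt_atTop R] with r hr
        exact (hG0 _ (hnorm (r, θ) hr)).symm
    simp only [Prod.swap_prod_mk, this]
    rw [setIntegral_const, Real.volume_real_Ioo_of_le (by linarith [Real.pi_pos]),
      Complex.real_smul]
    push_cast
    ring
  have hIB : ∫ p in Ioi (0 : ℝ) ×ˢ Ioo (-Real.pi) Real.pi, B p = 0 := by
    rw [Measure.volume_eq_prod, setIntegral_prod _ (by
      rw [← Measure.volume_eq_prod]; exact hBi)]
    refine (setIntegral_congr_fun measurableSet_Ioi (g := fun _ => 0) fun r hr => ?_).trans (by simp)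
    have h := intervalIntegral.integral_eq_sub_of_hasDerivAt (a := -Real.pi) (b := Real.pi)
      (fun θ _ => hder2 r θ) (Continuous.intervalIntegrable (by
        exact continuous_const.mul (hBc.comp (by fun_prop : Continuous fun θ : ℝ => (r, θ)))) _ _)
    have hpi : e Real.pi = e (-Real.pi) := by
      simp only [he, Complex.exp_pi_mul_I]
      push_cast
      rw [neg_mul, Complex.exp_neg, Complex.exp_pi_mul_I]; norm_num
    rw [hpi, sub_self, intervalIntegral.integral_const_mul, mul_eq_zero,
      intervalIntegral.integral_of_le (by linarith [Real.pi_pos]), integral_Ioc_eq_integral_Ioo] at h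
    rcases h with h | h
    · exact absurd (Complex.ofReal_eq_zero.1 h) (ne_of_gt hr)
    · exact h
  -- The Jacobian `r` cancels the modulus of `z⁻¹`, and `(e θ)⁻¹` is the conjugate of `e θ`. By
  -- `lin`, that conjugate is the factor by which the Cauchy-Riemann operator changes when the frame
  -- `1, i` is rotated by `θ`.
  have key : ∀ p ∈ Ioi (0 : ℝ) ×ˢ Ioo (-Real.pi) Real.pi,
      p.1 • ((Complex.polarCoord.symm p)⁻¹ * dbar G (Complex.polarCoord.symm p)) =
        A p + Complex.I * B p := by
    rintro ⟨r, θ⟩ ⟨hr, -⟩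
    have hr0 : (r : ℂ) ≠ 0 := Complex.ofReal_ne_zero.2 (ne_of_gt hr)
    have h1 : Complex.polarCoord.symm (r, θ) = r * e θ := by
      rw [Complex.polarCoord_symm_apply]; simp [he, Complex.exp_mul_I]
    have lin : ∀ (T : ℂ →L[ℝ] ℂ) (w : ℂ), T w + Complex.I * T (Complex.I * w) =
        (starRingEnd ℂ) w * (T 1 + Complex.I * T Complex.I) := by
      intro T w
      have e1 : w = w.re • (1 : ℂ) + w.im • Complex.I := by
        simp [Complex.real_smul, Complex.re_add_im]
      have e2 : Complex.I * w = w.re • Complex.I - w.im • (1 : ℂ) := by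
        apply Complex.ext <;> simp
      have e4 : T w = w.re • T 1 + w.im • T Complex.I := by
        conv_lhs => rw [e1]
        rw [map_add, map_smul, map_smul]
      rw [e2, map_sub, map_smul, map_smul, e4]
      have e3 : (starRingEnd ℂ) w = w.re - w.im * Complex.I := by
        apply Complex.ext <;> simp
      rw [e3]
      simp only [Complex.real_smul]
      linear_combination (w.im * T Complex.I) * Complex.I_sq
    have h2 : (e θ)⁻¹ = (starRingEnd ℂ) (e θ) := by
      rw [Complex.inv_def, Complex.normSq_eq_norm_sq, hen]; simp
    rw [h1, hA, hB, dbar]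
    simp only
    rw [lin, ← h2, Complex.real_smul]
    field_simp [he0 θ]
  rw [← Complex.integral_comp_polarCoord_symm]
  have ht : polarCoord.target = Ioi (0 : ℝ) ×ˢ Ioo (-Real.pi) Real.pi := rfl
  rw [ht, setIntegral_congr_fun (measurableSet_Ioi.prod measurableSet_Ioo) key,
    integral_add hAi (hBi.const_mul _), integral_const_mul, hIA, hIB]
  simp

end CauchyTransform

/-! ### The Cauchy transform and its estimates -/

section CauchyTransform
open MeasureTheory

/-- The Cauchy transform `(1/2π) ∫ q(ζ)/(z-ζ)`, a right inverse of `dbar`. -/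
noncomputable def cauchyTransform (q : ℂ → ℂ) (z : ℂ) : ℂ :=
  (2 * Real.pi : ℂ)⁻¹ * ∫ t, t⁻¹ * q (z - t)

theorem dbar_comp_const_sub {g : ℂ → ℂ} (hg : Differentiable ℝ g) (z t : ℂ) :
    dbar (fun t => g (z - t)) t = -dbar g (z - t) := by
  have h : HasFDerivAt (fun t => g (z - t)) (-(fderiv ℝ g (z - t))) t := by
    have h1 : HasFDerivAt (fun t : ℂ => z - t) (-(ContinuousLinearMap.id ℝ ℂ)) t :=
      (hasFDerivAt_id t).const_sub z
    refine ((hg (z - t)).hasFDerivAt.comp t h1).congr_fderiv ?_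
    ext; simp
  simp only [dbar, h.fderiv, neg_apply]
  ring

/-- The transform is a convolution, so derivatives fall on the smooth factor `q`. What remains is
the Cauchy-Pompeiu formula for `t ↦ q (z - t)`, where the reflection cancels the minus sign. -/
theorem hasFDerivAt_cauchyTransform {q : ℂ → ℂ} (hq : ContDiff ℝ 1 q) (hs : HasCompactSupport q)
    (z : ℂ) : DifferentiableAt ℝ (cauchyTransform q) z ∧ dbar (cauchyTransform q) z = q z := by
  set L : ℂ →L[ℝ] ℂ →L[ℝ] ℂ := ContinuousLinearMap.mul ℝ ℂ
  have hD := hs.hasFDerivAt_convolution_right L Complex.locallyIntegrable_inv hq z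
  have hT : cauchyTransform q = fun z => (2 * Real.pi : ℂ)⁻¹ *
      (convolution (fun z : ℂ => z⁻¹) q L volume) z := rfl
  have hD2 := hD.const_mul (2 * Real.pi : ℂ)⁻¹
  rw [← hT] at hD2
  refine ⟨hD2.differentiableAt, ?_⟩
  have hqc := hq.continuous_fderiv one_ne_zero
  have happ : ∀ v : ℂ, (convolution (fun z : ℂ => z⁻¹) (fderiv ℝ q) (L.precompR ℂ) volume) z v =
      ∫ t, t⁻¹ * fderiv ℝ q (z - t) v := fun v => by
    rw [convolution_precompR_apply L Complex.locallyIntegrable_inv (hs.fderiv ℝ) hqc]; rfl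
  have hint : ∀ v : ℂ, Integrable fun t : ℂ => t⁻¹ * fderiv ℝ q (z - t) v := fun v => by
    have hc : HasCompactSupport fun a => fderiv ℝ q a v :=
      (hs.fderiv ℝ).comp_left (g := fun T : ℂ →L[ℝ] ℂ => T v) (by simp)
    exact hc.convolutionExists_right L Complex.locallyIntegrable_inv (hqc.clm_apply continuous_const) z
  have h1 : ∫ t, t⁻¹ * dbar q (z - t) = 2 * Real.pi * q z := by
    have hG : ContDiff ℝ 1 fun t => q (z - t) := hq.comp (contDiff_const.sub contDiff_id)
    have hGs : HasCompactSupport fun t => q (z - t) :=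
      hs.comp_homeomorph (Homeomorph.subLeft z)
    have h := integral_inv_mul_dbar hG hGs
    simp only [dbar_comp_const_sub (hq.differentiable one_ne_zero), mul_neg, integral_neg,
      sub_zero] at h
    linear_combination -h
  have h2 : ∫ t, t⁻¹ * dbar q (z - t) = (∫ t, t⁻¹ * fderiv ℝ q (z - t) 1) +
      Complex.I * ∫ t, t⁻¹ * fderiv ℝ q (z - t) Complex.I := by
    rw [← integral_const_mul, ← integral_add (hint 1) ((hint _).const_mul _)]
    congr 1; ext t; simp only [dbar]; ring
  have hpi : (2 * Real.pi : ℂ) ≠ 0 := by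
    simp [Real.pi_ne_zero]
  rw [dbar, hD2.fderiv]
  simp only [smul_apply, happ, smul_eq_mul]
  rw [h2] at h1
  rw [mul_left_comm, ← mul_add, h1, inv_mul_cancel_left₀ hpi]

/-- The Cauchy kernel, truncated to a disk. -/
noncomputable def truncKernel (R : ℝ) : ℂ → ℂ := (Metric.ball 0 (2 * R)).indicator fun t => t⁻¹

theorem integrable_truncKernel (R : ℝ) : Integrable (truncKernel R) := by
  rw [truncKernel, integrable_indicator_iff measurableSet_ball]
  exact (Complex.locallyIntegrable_inv.integrableOn_isCompact
    (isCompact_closedBall 0 (2 * R))).mono_set Metric.ball_subset_closedBall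

/-- If `z` and `z - t` both lie in a ball of radius `R`, then `‖t‖ < 2R`. The truncated kernel is
integrable on the whole plane, which gives sup bounds, continuity and dominated convergence for
densities that are only bounded and measurable. -/
theorem cauchyTransform_eq {q : ℂ → ℂ} {c : ℂ} {R : ℝ} (hq : ∀ z ∉ Metric.ball c R, q z = 0) {z : ℂ}
    (hz : z ∈ Metric.ball c R) :
    cauchyTransform q z = (2 * Real.pi : ℂ)⁻¹ * ∫ t, truncKernel R t * q (z - t) := by
  rw [cauchyTransform]
  congr 2
  ext t
  by_cases ht : t ∈ Metric.ball (0 : ℂ) (2 * R)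
  · rw [truncKernel, indicator_of_mem ht]
  · rw [truncKernel, indicator_of_notMem ht, zero_mul, hq, mul_zero]
    intro h
    apply ht
    rw [mem_ball_zero_iff]
    rw [Metric.mem_ball, dist_eq_norm] at h hz
    have : t = (z - c) - (z - t - c) := by ring
    rw [this]
    linarith [norm_sub_le (z - c) (z - t - c)]

theorem norm_integral_mul_le {K q : ℂ → ℂ} (hK : Integrable K) {C : ℝ} (hC : ∀ z, ‖q z‖ ≤ C)
    (z : ℂ) : ‖∫ t, K t * q (z - t)‖ ≤ (∫ t, ‖K t‖) * C := by
  rw [← integral_mul_const]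
  refine norm_integral_le_of_norm_le (hK.norm.mul_const C) (Eventually.of_forall fun t => ?_)
  rw [norm_mul]
  exact mul_le_mul_of_nonneg_left (hC _) (norm_nonneg _)

theorem norm_cauchyTransform_le {q : ℂ → ℂ} {c : ℂ} {R C : ℝ}
    (hq : ∀ z ∉ Metric.ball c R, q z = 0) (hC : ∀ z, ‖q z‖ ≤ C) {z : ℂ}
    (hz : z ∈ Metric.ball c R) :
    ‖cauchyTransform q z‖ ≤ (2 * Real.pi)⁻¹ * ((∫ t, ‖truncKernel R t‖) * C) := by
  rw [cauchyTransform_eq hq hz, norm_mul]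
  have : ‖(2 * Real.pi : ℂ)⁻¹‖ = (2 * Real.pi)⁻¹ := by
    rw [norm_inv]; congr 1
    rw [norm_mul, Complex.norm_real, Real.norm_of_nonneg Real.pi_pos.le]; simp
  rw [this]
  exact mul_le_mul_of_nonneg_left (norm_integral_mul_le (integrable_truncKernel R) hC z)
    (by positivity)

/-- Approximating `K` in `L¹` by continuous compactly supported kernels approximates the convolution
uniformly, since `q` is bounded. -/
theorem continuous_integral_mul {K q : ℂ → ℂ} (hK : Integrable K) {C : ℝ}
    (hq : Measurable q) (hC : ∀ z, ‖q z‖ ≤ C) : Continuous fun z => ∫ t, K t * q (z - t) := by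
  have hC0 : 0 ≤ C := (norm_nonneg _).trans (hC 0)
  have hint : ∀ {K : ℂ → ℂ}, Integrable K → ∀ z, Integrable fun t => K t * q (z - t) :=
    fun {K} hK z => hK.mul_bdd
      (hq.comp (measurable_const.sub measurable_id)).aestronglyMeasurable
      (Eventually.of_forall fun t => hC _)
  refine continuous_of_uniform_approx_of_continuous fun u hu => ?_
  obtain ⟨ε, hε, hu⟩ := Metric.mem_uniformity_dist.1 hu
  -- The denominator uses `C + 1` so that it is positive also when `C = 0`.
  obtain ⟨k, hks, hkε, hkc, hki⟩ :=
    hK.exists_hasCompactSupport_integral_sub_le (ε := ε / (2 * (C + 1))) (by positivity)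
  refine ⟨fun z => ∫ t, k t * q (z - t), ?_, fun z => hu ?_⟩
  · have hloc : LocallyIntegrable q := fun z =>
      ⟨Metric.ball z 1, Metric.ball_mem_nhds z one_pos,
        Measure.integrableOn_of_bounded measure_ball_lt_top.ne hq.aestronglyMeasurable
          (Eventually.of_forall hC)⟩
    exact hks.continuous_convolution_left (ContinuousLinearMap.mul ℝ ℂ) hkc hloc
  · rw [dist_eq_norm, ← integral_sub (hint hK z) (hint hki z)]
    simp only [← sub_mul]
    refine (norm_integral_mul_le (hK.sub hki) hC z).trans_lt ?_
    simp only [Pi.sub_apply]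
    calc (∫ t, ‖K t - k t‖) * C ≤ ε / (2 * (C + 1)) * C := by gcongr
      _ < ε := by
        rw [div_mul_eq_mul_div, div_lt_iff₀ (by positivity)]
        nlinarith

theorem continuousOn_cauchyTransform {q : ℂ → ℂ} {c : ℂ} {R C : ℝ} (hm : Measurable q)
    (hq : ∀ z ∉ Metric.ball c R, q z = 0) (hC : ∀ z, ‖q z‖ ≤ C) :
    ContinuousOn (cauchyTransform q) (Metric.ball c R) :=
  (continuousOn_const.mul (continuous_integral_mul (integrable_truncKernel R) hm hC).continuousOn).congr
    fun _ hz => cauchyTransform_eq hq hz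

theorem tendsto_cauchyTransform {q : ℕ → ℂ → ℂ} {q' : ℂ → ℂ} {c : ℂ} {R C : ℝ}
    (hm : ∀ n, Measurable (q n)) (hq : ∀ n, ∀ z ∉ Metric.ball c R, q n z = 0)
    (hC : ∀ n z, ‖q n z‖ ≤ C) (hlim : ∀ z, Tendsto (fun n => q n z) atTop (𝓝 (q' z))) {z : ℂ}
    (hz : z ∈ Metric.ball c R) :
    Tendsto (fun n => cauchyTransform (q n) z) atTop (𝓝 (cauchyTransform q' z)) := by
  have hq' : ∀ z ∉ Metric.ball c R, q' z = 0 := fun z hz =>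
    tendsto_nhds_unique (hlim z) (by simp only [hq _ z hz]; exact tendsto_const_nhds)
  simp only [cauchyTransform_eq (hq _) hz, cauchyTransform_eq hq' hz]
  refine Tendsto.const_mul _ (tendsto_integral_of_dominated_convergence
    (fun t => ‖truncKernel R t‖ * C) (fun n => ?_) ((integrable_truncKernel R).norm.mul_const C)
    (fun n => Eventually.of_forall fun t => ?_) (Eventually.of_forall fun t => ?_))
  · exact (integrable_truncKernel R).aestronglyMeasurable.mul
      ((hm n).comp (measurable_const.sub measurable_id)).aestronglyMeasurable
  · rw [norm_mul]
    exact mul_le_mul_of_nonneg_left (hC _ _) (norm_nonneg _)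
  · exact (hlim _).const_mul _

end CauchyTransform

/-! ### A limit form of Morera's theorem -/

section Morera
open MeasureTheory

theorem measurable_dbar (f : ℂ → ℂ) : Measurable (dbar f) :=
  (measurable_fderiv_apply_const ℝ f 1).add
    ((measurable_fderiv_apply_const ℝ f Complex.I).const_mul Complex.I)

/-- A pointwise bounded limit of functions whose `dbar` derivatives tend boundedly to zero is
holomorphic, provided it is continuous. -/
theorem differentiableOn_of_tendsto_dbar {E : ℕ → ℂ → ℂ} {E' : ℂ → ℂ} {U : Set ℂ} (hU : IsOpen U)
    {M : ℝ} (hd : ∀ n, DifferentiableOn ℝ (E n) U) (hM : ∀ n, ∀ z ∈ U, ‖E n z‖ ≤ M)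
    (hM' : ∀ n, ∀ z ∈ U, ‖dbar (E n) z‖ ≤ M)
    (hlim : ∀ z ∈ U, Tendsto (fun n => E n z) atTop (𝓝 (E' z)))
    (hlim' : ∀ z ∈ U, Tendsto (fun n => dbar (E n) z) atTop (𝓝 0)) (hc : ContinuousOn E' U) :
    DifferentiableOn ℂ E' U := by
  rw [← Complex.isConservativeOn_and_continuousOn_iff_isDifferentiableOn hU]
  refine ⟨fun z w hzw => ?_, hc⟩
  have hmem : ∀ x ∈ uIcc z.re w.re, ∀ y ∈ uIcc z.im w.im, (x + y * Complex.I : ℂ) ∈ U :=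
    fun x hx y hy => hzw (by simp [Complex.Rectangle, Complex.mem_reProdIm, hx, hy])
  have hH : ∀ y ∈ uIcc z.im w.im, Tendsto (fun n => ∫ x : ℝ in z.re..w.re, E n (x + y * Complex.I))
      atTop (𝓝 (∫ x : ℝ in z.re..w.re, E' (x + y * Complex.I))) := fun y hy => by
    refine intervalIntegral.tendsto_integral_filter_of_dominated_convergence (fun _ => M)
      (Eventually.of_forall fun n => ?_) (Eventually.of_forall fun n => Eventually.of_forall
        fun x hx => hM n _ (hmem x (uIoc_subset_uIcc hx) y hy)) intervalIntegrable_const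
      (Eventually.of_forall fun x hx => hlim _ (hmem x (uIoc_subset_uIcc hx) y hy))
    refine ContinuousOn.aestronglyMeasurable ?_ measurableSet_uIoc
    exact (hd n).continuousOn.comp (by fun_prop) fun x hx => hmem x (uIoc_subset_uIcc hx) y hy
  have hV : ∀ x ∈ uIcc z.re w.re, Tendsto (fun n => ∫ y : ℝ in z.im..w.im, E n (x + y * Complex.I))
      atTop (𝓝 (∫ y : ℝ in z.im..w.im, E' (x + y * Complex.I))) := fun x hx => by
    refine intervalIntegral.tendsto_integral_filter_of_dominated_convergence (fun _ => M)
      (Eventually.of_forall fun n => ?_) (Eventually.of_forall fun n => Eventually.of_forall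
        fun y hy => hM n _ (hmem x hx y (uIoc_subset_uIcc hy))) intervalIntegrable_const
      (Eventually.of_forall fun y hy => hlim _ (hmem x hx y (uIoc_subset_uIcc hy)))
    refine ContinuousOn.aestronglyMeasurable ?_ measurableSet_uIoc
    exact (hd n).continuousOn.comp (by fun_prop) fun y hy => hmem x hx y (uIoc_subset_uIcc hy)
  have hA : Tendsto (fun n => ∫ x : ℝ in z.re..w.re, ∫ y : ℝ in z.im..w.im,
      Complex.I * dbar (E n) (x + y * Complex.I)) atTop (𝓝 0) := by
    have hmeas : ∀ n, Measurable fun p : ℝ × ℝ =>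
        Complex.I * dbar (E n) (p.1 + p.2 * Complex.I) := fun n =>
      ((measurable_dbar (E n)).comp (by fun_prop)).const_mul _
    have h0 : (0 : ℂ) = ∫ x : ℝ in z.re..w.re, (0 : ℂ) := by simp
    rw [h0]
    refine intervalIntegral.tendsto_integral_filter_of_dominated_convergence
      (fun _ => M * |w.im - z.im|)
      (Eventually.of_forall fun n => ?_) (Eventually.of_forall fun n => Eventually.of_forall
        fun x hx => ?_) intervalIntegrable_const (Eventually.of_forall fun x hx => ?_)
    · simp only [intervalIntegral.intervalIntegral_eq_integral_uIoc]
      exact ((hmeas n).stronglyMeasurable.integral_prod_right (ν := volume.restrict _)).const_smul _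
        |>.aestronglyMeasurable
    · refine intervalIntegral.norm_integral_le_of_norm_le_const fun y hy => ?_
      simpa using hM' n _ (hmem x (uIoc_subset_uIcc hx) y (uIoc_subset_uIcc hy))
    · have h0 : (0 : ℂ) = ∫ y : ℝ in z.im..w.im, (0 : ℂ) := by simp
      rw [h0]
      refine intervalIntegral.tendsto_integral_filter_of_dominated_convergence (fun _ => M)
        (Eventually.of_forall fun n => ?_) (Eventually.of_forall fun n => Eventually.of_forall
          fun y hy => ?_) intervalIntegrable_const (Eventually.of_forall fun y hy => ?_)
      · exact ((hmeas n).comp measurable_prodMk_left).aestronglyMeasurable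
      · simpa using hM' n _ (hmem x (uIoc_subset_uIcc hx) y (uIoc_subset_uIcc hy))
      · simpa using (hlim' _ (hmem x (uIoc_subset_uIcc hx) y (uIoc_subset_uIcc hy))).const_mul
          Complex.I
  -- Green's formula equates the boundary integral of `E n` over the rectangle with the area
  -- integral of `i * dbar (E n)`. The former tends to the boundary integral of `E'`, the latter to
  -- zero by `hA`.
  rw [← add_eq_zero_iff_eq_neg, Complex.wedgeIntegral_add_wedgeIntegral_eq]
  refine tendsto_nhds_unique ((((hH _ left_mem_uIcc).sub (hH _ right_mem_uIcc)).add
    ((hV _ right_mem_uIcc).const_smul Complex.I)).sub ((hV _ left_mem_uIcc).const_smul Complex.I))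
    (hA.congr fun n => ?_)
  have hI : ∀ ζ, Complex.I • fderiv ℝ (E n) ζ 1 - fderiv ℝ (E n) ζ Complex.I =
      Complex.I * dbar (E n) ζ := fun ζ => by
    simp only [dbar, smul_eq_mul]
    linear_combination (-fderiv ℝ (E n) ζ Complex.I) * Complex.I_sq
  have h := Complex.integral_boundary_rect_of_differentiableOn_real (E n) z w ((hd n).mono hzw) ?_
  · rw [h]
    simp only [hI]
  · simp only [hI]
    have hcpt : IsCompact (uIcc z.re w.re ×ℂ uIcc z.im w.im) := isCompact_uIcc.reProdIm isCompact_uIcc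
    refine Measure.integrableOn_of_bounded (M := M) hcpt.measure_lt_top.ne
      ((measurable_dbar (E n)).const_mul _).aestronglyMeasurable ?_
    refine (ae_restrict_iff' hcpt.measurableSet).2 (Eventually.of_forall fun ζ hζ => ?_)
    simpa using hM' n ζ (hzw hζ)

end Morera

/-! ### The similarity principle -/

section Similarity
open MeasureTheory

theorem contDiffOn_dbar {k : ℂ → ℂ} {U : Set ℂ} (hU : IsOpen U) (hk : ContDiffOn ℝ 2 k U) :
    ContDiffOn ℝ 1 (dbar k) U := by
  have h := hk.fderiv_of_isOpen hU (m := 1) (by norm_num)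
  exact (h.clm_apply contDiffOn_const).add (contDiffOn_const.mul (h.clm_apply contDiffOn_const))

theorem dbar_exp_neg_mul {s k : ℂ → ℂ} {z : ℂ} (hs : DifferentiableAt ℝ s z)
    (hk : DifferentiableAt ℝ k z) :
    dbar (fun z => Complex.exp (-s z) * k z) z =
      Complex.exp (-s z) * (dbar k z - dbar s z * k z) := by
  have h : HasFDerivAt (fun z => Complex.exp (-s z) * k z) _ z :=
    (hs.hasFDerivAt.neg.cexp).mul hk.hasFDerivAt
  rw [dbar, h.fderiv]
  simp only [dbar, _root_.add_apply, smul_apply, neg_apply, smul_eq_mul,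
    Pi.neg_apply]
  ring

/-- The similarity principle of Carleman, Bers and Vekua. -/
theorem exists_exp_mul_holomorphic {k : ℂ → ℂ} {c : ℂ} {R C : ℝ} (hR : 0 < R) (hC0 : 0 ≤ C)
    (hk : ContDiffOn ℝ 2 k (Metric.ball c R))
    (hC : ∀ z ∈ Metric.ball c R, ‖dbar k z‖ ≤ C * ‖k z‖) :
    ∃ r, 0 < r ∧ r ≤ R ∧ ∃ s σ : ℂ → ℂ, ContinuousOn s (Metric.ball c r) ∧
      DifferentiableOn ℂ σ (Metric.ball c r) ∧
      ∀ z ∈ Metric.ball c r, k z = Complex.exp (s z) * σ z := by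
  -- The cutoff is `1` on the ball of radius `R / 3`, where the conclusion is drawn, and vanishes
  -- outside the ball of radius `R / 2`, so that the densities extend by zero.
  let χ : ContDiffBump c := ⟨R / 3, R / 2, by positivity, by linarith⟩
  set B := Metric.ball c R with hB
  have hBo : IsOpen B := Metric.isOpen_ball
  have hsupp : Metric.closedBall c (R / 2) ⊆ B := Metric.closedBall_subset_ball (by linarith)
  have hχ0 : ∀ z ∉ Metric.closedBall c (R / 2), χ z = 0 := fun z hz =>
    χ.zero_of_le_dist (by
      rw [Metric.mem_closedBall, not_le] at hz
      exact hz.le)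
  set ε : ℕ → ℝ := fun n => 1 / ((n : ℝ) + 1) with hε
  have hε0 : ∀ n, 0 < ε n := fun n => Nat.one_div_pos_of_nat
  -- The exponent should be the Cauchy transform of `dbar k / k`, which is bounded but may be
  -- discontinuous at zeros of `k`; its transform need not be differentiable. The quotient is
  -- therefore regularised as `dbar k * conj k / (|k|² + ε)`, which is `C¹`, is bounded by `C`
  -- uniformly in `ε`, and converges pointwise.
  set q : ℕ → ℂ → ℂ := fun n z =>
    (χ z * (Complex.normSq (k z) + ε n)⁻¹) • (dbar k z * (starRingEnd ℂ) (k z)) with hq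
  set q' : ℂ → ℂ := fun z => (χ z : ℂ) * (dbar k z / k z) with hq'
  have hqsupp : ∀ n, ∀ z ∉ Metric.closedBall c (R / 2), q n z = 0 := fun n z hz => by
    simp [hq, hχ0 z hz]
  have hqsupp' : ∀ n, ∀ z ∉ B, q n z = 0 := fun n z hz => hqsupp n z fun h => hz (hsupp h)
  have hqs : ∀ n, ContDiff ℝ 1 (q n) := fun n => by
    rw [contDiff_iff_contDiffAt]
    intro z
    by_cases hz : z ∈ B
    · have hzB : B ∈ 𝓝 z := hBo.mem_nhds hz
      have hk1 : ContDiffAt ℝ 1 k z := (hk.contDiffAt hzB).of_le (by norm_num)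
      have hdk : ContDiffAt ℝ 1 (dbar k) z := (contDiffOn_dbar hBo hk).contDiffAt hzB
      have hconj : ContDiffAt ℝ 1 (fun z => (starRingEnd ℂ) (k z)) z :=
        Complex.conjCLE.contDiff.contDiffAt.comp z hk1
      have hns : ContDiffAt ℝ 1 (fun z => Complex.normSq (k z)) z := by
        have : (fun z => Complex.normSq (k z)) = fun z => ‖k z‖ ^ 2 :=
          funext fun z => Complex.normSq_eq_norm_sq _
        rw [this]
        exact hk1.norm_sq ℝ
      refine ((χ.contDiff.contDiffAt (n := 1)).mul
        ((hns.add contDiffAt_const).inv ?_)).smul (hdk.mul hconj)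
      exact (add_pos_of_nonneg_of_pos (Complex.normSq_nonneg _) (hε0 n)).ne'
    · have : (Metric.closedBall c (R / 2))ᶜ ∈ 𝓝 z :=
        Metric.isClosed_closedBall.isOpen_compl.mem_nhds fun h => hz (hsupp h)
      refine (contDiffAt_const (c := (0 : ℂ))).congr_of_eventuallyEq ?_
      filter_upwards [this] with w hw using hqsupp n w hw
  have hqcs : ∀ n, HasCompactSupport (q n) := fun n =>
    HasCompactSupport.intro (isCompact_closedBall c (R / 2)) (hqsupp n)
  have hqC : ∀ n z, ‖q n z‖ ≤ C := fun n z => by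
    by_cases hz : z ∈ B
    · have hpos : 0 < Complex.normSq (k z) + ε n :=
        add_pos_of_nonneg_of_pos (Complex.normSq_nonneg _) (hε0 n)
      rw [hq]
      simp only
      rw [norm_smul, norm_mul, norm_mul, RCLike.norm_conj, Real.norm_of_nonneg χ.nonneg,
        norm_inv, Real.norm_of_nonneg hpos.le]
      calc χ z * (Complex.normSq (k z) + ε n)⁻¹ * (‖dbar k z‖ * ‖k z‖)
          ≤ 1 * (Complex.normSq (k z) + ε n)⁻¹ * (C * ‖k z‖ * ‖k z‖) := by
            gcongr
            · exact χ.le_one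
            · exact hC z hz
        _ = C * (Complex.normSq (k z) * (Complex.normSq (k z) + ε n)⁻¹) := by
            rw [Complex.normSq_eq_norm_sq]; ring
        _ ≤ C * 1 := by
            gcongr
            rw [← div_eq_mul_inv, div_le_one hpos]
            linarith [hε0 n]
        _ = C := mul_one C
    · rw [hqsupp' n z hz, norm_zero]; exact hC0
  have hεlim : Tendsto ε atTop (𝓝 0) := tendsto_one_div_add_atTop_nhds_zero_nat
  have hqlim : ∀ z, Tendsto (fun n => q n z) atTop (𝓝 (q' z)) := fun z => by
    -- At a zero of `k` the convention `x / 0 = 0` makes `q'` vanish, in agreement with every `q n`.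
    by_cases hz : k z = 0
    · simp only [hq, hq', hz]; simp
    · have hn : Complex.normSq (k z) ≠ 0 := fun h => hz (Complex.normSq_eq_zero.1 h)
      have h1 : Tendsto (fun n => (Complex.normSq (k z) + ε n)⁻¹) atTop
          (𝓝 (Complex.normSq (k z) + 0)⁻¹) :=
        (tendsto_const_nhds.add hεlim).inv₀ (by simpa using hn)
      have h2 := (h1.const_mul (χ z)).smul_const (dbar k z * (starRingEnd ℂ) (k z))
      convert h2 using 2
      simp only [hq']
      rw [add_zero, div_eq_mul_inv, Complex.inv_def, Complex.real_smul]
      push_cast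
      ring
  have hqm : ∀ n, Measurable (q n) := fun n => (hqs n).continuous.measurable
  have hq'm : Measurable q' := measurable_of_tendsto_metrizable hqm (tendsto_pi_nhds.2 hqlim)
  have hq'C : ∀ z, ‖q' z‖ ≤ C := fun z =>
    le_of_tendsto (hqlim z).norm (Eventually.of_forall fun n => hqC n z)
  have hq'supp : ∀ z ∉ B, q' z = 0 := fun z hz =>
    tendsto_nhds_unique (hqlim z) (by simp only [hqsupp' _ z hz]; exact tendsto_const_nhds)
  set s : ℂ → ℂ := cauchyTransform q' with hs
  have hsc : ContinuousOn s B := continuousOn_cauchyTransform hq'm hq'supp hq'C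
  set M := (2 * Real.pi)⁻¹ * ((∫ t, ‖truncKernel R t‖) * C) with hM
  set U := Metric.ball c (R / 3) with hU
  have hUB : U ⊆ B := Metric.ball_subset_ball (by linarith)
  have hUB' : U ⊆ Metric.closedBall c (R / 2) :=
    Metric.ball_subset_closedBall.trans (Metric.closedBall_subset_closedBall (by linarith))
  have hχ1 : ∀ z ∈ U, χ z = 1 := fun z hz => χ.one_of_mem_closedBall (Metric.ball_subset_closedBall hz)
  obtain ⟨N, hN⟩ := (isCompact_closedBall c (R / 2)).exists_bound_of_continuousOn
    (hk.continuousOn.mono hsupp)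
  have hN0 : 0 ≤ N := (norm_nonneg _).trans (hN c (Metric.mem_closedBall_self (by positivity)))
  -- These functions are genuinely differentiable, and their `dbar` is `exp(-s_n) (q' - q n) k`,
  -- which is bounded and tends to zero. The limit form of Morera's theorem then makes `exp(-s) k`
  -- holomorphic without differentiating `s`.
  set E : ℕ → ℂ → ℂ := fun n z => Complex.exp (-cauchyTransform (q n) z) * k z with hE
  have hkd : ∀ z ∈ B, DifferentiableAt ℝ k z := fun z hz =>
    (hk.contDiffAt (hBo.mem_nhds hz)).differentiableAt (by norm_num)
  have hsd := fun n => hasFDerivAt_cauchyTransform (hqs n) (hqcs n)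
  have hexp : ∀ n, ∀ z ∈ B, ‖Complex.exp (-cauchyTransform (q n) z)‖ ≤ Real.exp M := fun n z hz => by
    rw [Complex.norm_exp]
    refine Real.exp_le_exp.2 ((Complex.re_le_norm _).trans ?_)
    rw [norm_neg]
    exact norm_cauchyTransform_le (hqsupp' n) (hqC n) hz
  have hdE : ∀ n, ∀ z ∈ U, dbar (E n) z =
      Complex.exp (-cauchyTransform (q n) z) * ((q' z - q n z) * k z) := fun n z hz => by
    rw [hE]
    simp only
    rw [dbar_exp_neg_mul (hsd n z).1 (hkd z (hUB hz)), (hsd n z).2]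
    congr 1
    simp only [hq']
    rw [sub_mul, hχ1 z hz]
    congr 1
    -- At a zero of `k` the assumed inequality forces `dbar k = 0`, so `dbar k = q' * k` survives
    -- the division by zero.
    by_cases h0 : k z = 0
    · have := hC z (hUB hz)
      rw [h0, norm_zero, mul_zero] at this
      rw [h0, mul_zero, norm_le_zero_iff.1 this]
    · simp [div_mul_cancel₀ _ h0]
  have hholo : DifferentiableOn ℂ (fun z => Complex.exp (-s z) * k z) U := by
    have hlimexp : ∀ z ∈ U, Tendsto (fun n => Complex.exp (-cauchyTransform (q n) z)) atTop
        (𝓝 (Complex.exp (-s z))) := fun z hz =>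
      (Complex.continuous_exp.tendsto _).comp
        (tendsto_cauchyTransform hqm hqsupp' hqC hqlim (hUB hz)).neg
    refine differentiableOn_of_tendsto_dbar (E := E) Metric.isOpen_ball
      (M := max (Real.exp M * N) (Real.exp M * ((C + C) * N)))
      (fun n z hz => ?_) (fun n z hz => ?_) (fun n z hz => ?_) (fun z hz => ?_) (fun z hz => ?_) ?_
    · exact ((hsd n z).1.neg.cexp.mul (hkd z (hUB hz))).differentiableWithinAt
    · refine le_max_of_le_left ?_
      rw [norm_mul]
      exact mul_le_mul (hexp n z (hUB hz)) (hN z (hUB' hz)) (norm_nonneg _) (Real.exp_nonneg _)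
    · refine le_max_of_le_right ?_
      rw [hdE n z hz, norm_mul, norm_mul]
      refine mul_le_mul (hexp n z (hUB hz)) (mul_le_mul ?_ (hN z (hUB' hz)) (norm_nonneg _)
        (by positivity)) (by positivity) (Real.exp_nonneg _)
      exact (norm_sub_le _ _).trans (add_le_add (hq'C z) (hqC n z))
    · exact (hlimexp z hz).mul_const _
    · have h := (hlimexp z hz).mul (((tendsto_const_nhds (x := q' z)).sub (hqlim z)).mul_const (k z))
      rw [sub_self, zero_mul, mul_zero] at h
      exact h.congr fun n => (hdE n z hz).symm
    · exact ((hsc.mono hUB).neg.cexp).mul (hk.continuousOn.mono hUB)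
  refine ⟨R / 3, by positivity, by linarith, s, fun z => Complex.exp (-s z) * k z, hsc.mono hUB,
    hholo, fun z _ => ?_⟩
  rw [← mul_assoc, ← Complex.exp_add, add_neg_cancel, Complex.exp_zero, one_mul]

end Similarity

/-! ### Winding numbers around zeros -/

section Winding

/-- On a small ball `G / G c` stays in the slit plane, so its principal argument is continuous and
returns to its initial value around the circle. All of the growth of the argument comes from the
term `n * θ`. -/
theorem eventually_hasWindingNumber {G h : ℂ → ℂ} {c : ℂ} {n : ℕ} (hG : ∀ᶠ z in 𝓝 c, ContinuousAt G z)
    (hG0 : G c ≠ 0) (hh : ∀ᶠ z in 𝓝 c, h z = (z - c) ^ n * G z) :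
    ∀ᶠ ρ : ℝ in 𝓝[>] 0, HasWindingNumber (fun θ => h (circleMap c ρ θ)) n := by
  have hslit : ∀ᶠ z in 𝓝 c, G z / G c ∈ Complex.slitPlane := by
    have h1 : ContinuousAt (fun z => G z / G c) c := hG.self_of_nhds.div_const _
    refine h1.eventually (Complex.isOpen_slitPlane.mem_nhds ?_)
    simp only [div_self hG0]; exact Complex.one_mem_slitPlane
  obtain ⟨δ, hδ, H⟩ := Metric.eventually_nhds_iff_ball.1 (hG.and (hh.and hslit))
  filter_upwards [Ioo_mem_nhdsGT hδ] with ρ hρ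
  have hmem : ∀ θ, circleMap c ρ θ ∈ Metric.ball c δ := fun θ => by
    rw [Metric.mem_ball, dist_eq_norm, circleMap_sub_center, norm_circleMap_zero, abs_of_pos hρ.1]
    exact hρ.2
  refine ⟨fun θ => n * θ + (Complex.arg (G (circleMap c ρ θ) / G c) + Complex.arg (G c)),
    Continuous.continuousOn ?_, fun θ _ => ?_, ?_⟩
  · refine (continuous_const.mul continuous_id).add (Continuous.add ?_ continuous_const)
    refine continuous_iff_continuousAt.2 fun θ => ?_
    have h1 : ContinuousAt (fun θ => G (circleMap c ρ θ)) θ :=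
      (H _ (hmem θ)).1.comp (f := circleMap c ρ) (continuous_circleMap c ρ).continuousAt
    exact (Complex.continuousAt_arg (H _ (hmem θ)).2.2).comp (f := fun θ => G (circleMap c ρ θ) / G c)
      (h1.div_const _)
  · obtain ⟨-, h1, h2⟩ := H _ (hmem θ)
    set w := G (circleMap c ρ θ) with hw
    have hw0 : w ≠ 0 := fun h0 => Complex.slitPlane_ne_zero h2 (by rw [h0, zero_div])
    have hρ0 : (ρ : ℂ) ≠ 0 := Complex.ofReal_ne_zero.2 hρ.1.ne'
    have e1 : w = ‖w‖ * Complex.exp (Complex.I * (Complex.arg (w / G c) + Complex.arg (G c))) := by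
      have a1 := Complex.norm_mul_exp_arg_mul_I (w / G c)
      have a2 := Complex.norm_mul_exp_arg_mul_I (G c)
      have hn : (‖G c‖ : ℂ) ≠ 0 := by simpa using hG0
      rw [mul_add, Complex.exp_add, mul_comm Complex.I, mul_comm Complex.I]
      rw [norm_div, Complex.ofReal_div, div_mul_eq_mul_div, div_eq_div_iff hn hG0] at a1
      refine mul_right_cancel₀ hn (a1.symm.trans ?_)
      nth_rewrite 2 [← a2]
      ring
    have hγ : h (circleMap c ρ θ) = ρ ^ n * Complex.exp (n * (θ * Complex.I)) * w := by
      rw [h1, circleMap_sub_center, circleMap_zero, mul_pow, ← Complex.exp_nat_mul]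
    have hnorm : ‖h (circleMap c ρ θ)‖ = ρ ^ n * ‖w‖ := by
      rw [h1, circleMap_sub_center, norm_mul, norm_pow, norm_circleMap_zero, abs_of_pos hρ.1]
    show h (circleMap c ρ θ) ≠ 0 ∧ h (circleMap c ρ θ) = (‖h (circleMap c ρ θ)‖ : ℂ) * _
    refine ⟨by rw [hγ]; exact mul_ne_zero (mul_ne_zero (pow_ne_zero _ hρ0) (Complex.exp_ne_zero _)) hw0, ?_⟩
    rw [hnorm, hγ]
    conv_lhs => rw [e1]
    push_cast
    have : Complex.I * (n * θ : ℂ) = n * (θ * Complex.I) := by ring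
    rw [mul_add Complex.I (n * θ : ℂ), Complex.exp_add, this]; ring
  · have : circleMap c ρ (2 * Real.pi) = circleMap c ρ 0 := by simp [circleMap]
    simp only [this]
    push_cast
    ring

/-- Zeros of `F * σ` with `F` continuous and nowhere zero and `σ` holomorphic. -/
theorem zeros_of_mul_holomorphic {F σ : ℂ → ℂ} {c : ℂ} (hF : ∀ᶠ z in 𝓝 c, ContinuousAt F z)
    (hF0 : F c ≠ 0) (hσ : AnalyticAt ℂ σ c) :
    (∀ᶠ z in 𝓝 c, σ z = 0) ∨ (∀ᶠ z in 𝓝[≠] c, σ z ≠ 0) ∧ (σ c = 0 → ∃ k : ℤ, 0 < k ∧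
      ∀ h : ℂ → ℂ, (∀ᶠ z in 𝓝 c, h z = F z * σ z) →
        ∀ᶠ ρ : ℝ in 𝓝[>] 0, HasWindingNumber (fun θ => h (circleMap c ρ θ)) k) := by
  rcases hσ.eventually_eq_zero_or_eventually_ne_zero with h0 | h0
  · exact Or.inl h0
  refine Or.inr ⟨h0, fun hc => ?_⟩
  have hne : ¬ ∀ᶠ z in 𝓝 c, σ z = 0 := fun h =>
    (h0.and (h.filter_mono nhdsWithin_le_nhds)).exists.elim fun z hz => hz.1 hz.2
  -- The index is the order of vanishing of `σ` at `c`; it is positive because `σ c = 0`.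
  obtain ⟨n, g, hg, hg0, hgσ⟩ := hσ.exists_eventuallyEq_pow_smul_nonzero_iff.2 hne
  have hn : n ≠ 0 := fun hn => by
    have := hgσ.self_of_nhds
    rw [hn, hc, pow_zero, one_smul] at this
    exact hg0 this.symm
  refine ⟨n, by positivity, fun h hh => ?_⟩
  refine eventually_hasWindingNumber (G := fun z => F z * g z) ?_ (mul_ne_zero hF0 hg0) ?_
  · filter_upwards [hF, hg.eventually_analyticAt] with z h1 h2 using h1.mul h2.continuousAt
  · filter_upwards [hh, hgσ] with z h1 h2
    rw [h1, h2, smul_eq_mul]; ring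

end Winding

/-! ### Linear algebra of anti-invariant 2-forms -/

section TwoFormAlgebra

variable {E : Type*} [AddCommGroup E] [Module ℝ E] [TopologicalSpace E]

theorem twoForm_add_left (β : E [⋀^Fin 2]→L[ℝ] ℝ) (a b c : E) :
    β ![a + b, c] = β ![a, c] + β ![b, c] :=
  β.toContinuousMultilinearMap.cons_add ![c] a b

theorem twoForm_smul_left (β : E [⋀^Fin 2]→L[ℝ] ℝ) (t : ℝ) (a c : E) :
    β ![t • a, c] = t * β ![a, c] :=
  β.toContinuousMultilinearMap.cons_smul ![c] t a

theorem twoForm_swap (β : E [⋀^Fin 2]→L[ℝ] ℝ) (a b : E) : β ![a, b] = -β ![b, a] := by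
  have := β.toAlternatingMap.map_swap ![b, a] (i := 0) (j := 1) (by decide)
  have h2 : (![b, a] ∘ Equiv.swap (0 : Fin 2) 1) = ![a, b] := by
    ext i; fin_cases i <;> simp
  rw [h2] at this
  exact this

theorem twoForm_self (β : E [⋀^Fin 2]→L[ℝ] ℝ) (a : E) : β ![a, a] = 0 := by
  linarith [twoForm_swap β a a]

theorem twoForm_add_right (β : E [⋀^Fin 2]→L[ℝ] ℝ) (a b c : E) :
    β ![c, a + b] = β ![c, a] + β ![c, b] := by
  rw [twoForm_swap, twoForm_add_left, twoForm_swap β a, twoForm_swap β b]; ring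

theorem twoForm_smul_right (β : E [⋀^Fin 2]→L[ℝ] ℝ) (t : ℝ) (a c : E) :
    β ![c, t • a] = t * β ![c, a] := by
  rw [twoForm_swap, twoForm_smul_left, twoForm_swap β a]; ring

theorem twoForm_neg_left (β : E [⋀^Fin 2]→L[ℝ] ℝ) (a c : E) : β ![-a, c] = -β ![a, c] := by
  rw [← neg_one_smul ℝ a, twoForm_smul_left]; ring

theorem twoForm_neg_right (β : E [⋀^Fin 2]→L[ℝ] ℝ) (a c : E) : β ![c, -a] = -β ![c, a] := by
  rw [← neg_one_smul ℝ a, twoForm_smul_right]; ring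

theorem twoForm_ext {β γ : E [⋀^Fin 2]→L[ℝ] ℝ} (h : ∀ a b, β ![a, b] = γ ![a, b]) : β = γ := by
  ext v
  have : v = ![v 0, v 1] := by ext i; fin_cases i <;> rfl
  rw [this]; exact h _ _

theorem compContinuousLinearMap_two {E' : Type*} [AddCommGroup E'] [Module ℝ E']
    [TopologicalSpace E'] (β : E [⋀^Fin 2]→L[ℝ] ℝ) (L : E' →L[ℝ] E) (a b : E') :
    β.compContinuousLinearMap L ![a, b] = β ![L a, L b] := by
  rw [ContinuousAlternatingMap.compContinuousLinearMap_apply]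
  congr 1
  ext i; fin_cases i <;> rfl

/-- The wedge product of two functionals. -/
def wedgeTwo (l m : E →L[ℝ] ℝ) : E [⋀^Fin 2]→L[ℝ] ℝ where
  toFun v := l (v 0) * m (v 1) - l (v 1) * m (v 0)
  map_update_add' v i x y := by
    fin_cases i <;> simp [Function.update] <;> ring
  map_update_smul' v i c x := by
    fin_cases i <;> simp [Function.update] <;> ring
  map_eq_zero_of_eq' v i j h hij := by
    have : v 0 = v 1 := by
      fin_cases i <;> fin_cases j <;> simp_all
    rw [this]; ring
  cont := by fun_prop

/-- Forms with `β (j v, j w) = -β (v, w)`. -/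
def IsAntiInvariant (j : E →L[ℝ] E) (β : E [⋀^Fin 2]→L[ℝ] ℝ) : Prop :=
  ∀ v w, β ![j v, j w] = -β ![v, w]

/-- The `j`-complex coordinate of a 2-form given by a pair of vectors. -/
noncomputable def twoFormCoord (j : E →L[ℝ] E) (a b : E) (β : E [⋀^Fin 2]→L[ℝ] ℝ) : ℂ :=
  (β ![a, b] : ℂ) - Complex.I * (β ![j a, b] : ℂ)

variable {j : E →L[ℝ] E}

theorem IsAntiInvariant.apply_right (hj : ∀ v, j (j v) = -v) {β : E [⋀^Fin 2]→L[ℝ] ℝ}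
    (hβ : IsAntiInvariant j β) (v w : E) : β ![v, j w] = β ![j v, w] := by
  have := hβ v (j w)
  rw [hj, twoForm_neg_right] at this
  linarith

theorem IsAntiInvariant.apply_self (hj : ∀ v, j (j v) = -v) {β : E [⋀^Fin 2]→L[ℝ] ℝ}
    (hβ : IsAntiInvariant j β) (v : E) : β ![v, j v] = 0 := by
  linarith [hβ.apply_right hj v v, twoForm_swap β v (j v)]

/-- Pairing a linear relation with `b`, `j b`, `a` and `j a` separates it into two 2 by 2 systems,
for the coefficients of `a, j a` and of `b, j b`. -/
theorem linearIndependent_of_twoFormCoord_ne_zero (hj : ∀ v, j (j v) = -v)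
    {β : E [⋀^Fin 2]→L[ℝ] ℝ} (hβ : IsAntiInvariant j β) {a b : E} (h : twoFormCoord j a b β ≠ 0) :
    LinearIndependent ℝ ![a, j a, b, j b] := by
  have hpq : β ![a, b] ^ 2 + β ![j a, b] ^ 2 ≠ 0 := by
    intro h0
    have h1 : β ![a, b] = 0 := by nlinarith [sq_nonneg (β ![a, b]), sq_nonneg (β ![j a, b])]
    have h2 : β ![j a, b] = 0 := by nlinarith [sq_nonneg (β ![a, b]), sq_nonneg (β ![j a, b])]
    exact h (by simp [twoFormCoord, h1, h2])
  rw [Fintype.linearIndependent_iff]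
  intro g hg
  simp only [Fin.sum_univ_four, Matrix.cons_val_zero, Matrix.cons_val_one, Matrix.cons_val_two,
    Matrix.cons_val_three, Matrix.head_cons, Matrix.tail_cons] at hg
  have e1 : β ![g 0 • a + g 1 • j a + g 2 • b + g 3 • j b, b] = 0 := by
    rw [hg]; simpa using twoForm_smul_left β 0 0 b
  have e2 : β ![g 0 • a + g 1 • j a + g 2 • b + g 3 • j b, j b] = 0 := by
    rw [hg]; simpa using twoForm_smul_left β 0 0 (j b)
  have e3 : β ![a, g 0 • a + g 1 • j a + g 2 • b + g 3 • j b] = 0 := by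
    rw [hg]; simpa using twoForm_smul_right β 0 0 a
  have e4 : β ![j a, g 0 • a + g 1 • j a + g 2 • b + g 3 • j b] = 0 := by
    rw [hg]; simpa using twoForm_smul_right β 0 0 (j a)
  have s1 := hβ.apply_self hj a
  have s2 := hβ.apply_self hj b
  have s3 := hβ.apply_right hj a b
  have s4 := hβ a b
  have s5 := twoForm_swap β (j a) a
  have s6 := twoForm_swap β (j b) b
  simp only [twoForm_add_left, twoForm_smul_left, twoForm_add_right, twoForm_smul_right,
    twoForm_self] at e1 e2 e3 e4
  rw [s6, s2] at e1
  rw [s3, s4, s2] at e2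
  rw [s1, s3] at e3
  rw [s5, s1, s4] at e4
  set p := β ![a, b]
  set q := β ![j a, b]
  -- Both systems have determinant `-(p² + q²)`, which is nonzero; these are their solutions by
  -- Cramer's rule.
  have c0 : g 0 * (p ^ 2 + q ^ 2) = 0 := by linear_combination p * e1 + q * e2
  have c1 : g 1 * (p ^ 2 + q ^ 2) = 0 := by linear_combination q * e1 - p * e2
  have c2 : g 2 * (p ^ 2 + q ^ 2) = 0 := by linear_combination p * e3 + q * e4
  have c3 : g 3 * (p ^ 2 + q ^ 2) = 0 := by linear_combination q * e3 - p * e4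
  intro i
  fin_cases i
  · exact (mul_eq_zero.1 c0).resolve_right hpq
  · exact (mul_eq_zero.1 c1).resolve_right hpq
  · exact (mul_eq_zero.1 c2).resolve_right hpq
  · exact (mul_eq_zero.1 c3).resolve_right hpq

/-- On the basis `a, j a, b, j b` anti-invariance determines every value of the form from `γ(a, b)`
and `γ(j a, b)`. So in real dimension four the anti-invariant forms make up one complex line. -/
theorem eq_zero_of_twoFormCoord_eq_zero (hd : Module.finrank ℝ E = 4) (hj : ∀ v, j (j v) = -v)
    {a b : E} (hli : LinearIndependent ℝ ![a, j a, b, j b])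
    {γ : E [⋀^Fin 2]→L[ℝ] ℝ} (hγ : IsAntiInvariant j γ) (h : twoFormCoord j a b γ = 0) : γ = 0 := by
  have h1 : γ ![a, b] = 0 := by simpa [twoFormCoord] using congrArg Complex.re h
  have h2 : γ ![j a, b] = 0 := by simpa [twoFormCoord] using congrArg Complex.im h
  have hb := hli.span_eq_top_of_card_eq_finrank (by simp [hd])
  have hgen : ∀ v : E, ∃ x y z w : ℝ, v = x • a + y • j a + z • b + w • j b := fun v => by
    have hv : v ∈ Submodule.span ℝ (Set.range ![a, j a, b, j b]) := by rw [hb]; trivial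
    obtain ⟨c, hc⟩ := (Submodule.mem_span_range_iff_exists_fun ℝ).1 hv
    refine ⟨c 0, c 1, c 2, c 3, ?_⟩
    rw [← hc]
    simp [Fin.sum_univ_four]
  have s1 := hγ.apply_self hj a
  have s2 := hγ.apply_self hj b
  have s3 := hγ.apply_right hj a b
  have s4 := hγ a b
  rw [h2] at s3
  rw [h1, neg_zero] at s4
  refine twoForm_ext fun v w => ?_
  obtain ⟨x, y, z, t, rfl⟩ := hgen v
  obtain ⟨x', y', z', t', rfl⟩ := hgen w
  simp only [twoForm_add_left, twoForm_smul_left, twoForm_add_right, twoForm_smul_right,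
    twoForm_self, h1, h2, s1, s2, s3, s4, twoForm_swap γ (j a) a, twoForm_swap γ b a,
    twoForm_swap γ b (j a), twoForm_swap γ (j b) a, twoForm_swap γ (j b) (j a),
    twoForm_swap γ (j b) b]
  simp

theorem twoFormCoord_sub (a b : E) (β γ : E [⋀^Fin 2]→L[ℝ] ℝ) :
    twoFormCoord j a b (β - γ) = twoFormCoord j a b β - twoFormCoord j a b γ := by
  simp [twoFormCoord]; ring

theorem IsAntiInvariant.compContinuousLinearMap {E' : Type*} [AddCommGroup E'] [Module ℝ E']
    [TopologicalSpace E'] {j' : E' →L[ℝ] E'} {L : E' →L[ℝ] E}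
    (hL : ∀ v, L (j' v) = j (L v)) {β : E [⋀^Fin 2]→L[ℝ] ℝ} (hβ : IsAntiInvariant j β) :
    IsAntiInvariant j' (β.compContinuousLinearMap L) := fun v w => by
  rw [compContinuousLinearMap_two, compContinuousLinearMap_two, hL, hL, hβ]

variable [ContinuousAdd E]

/-- The complex structure on anti-invariant 2-forms. -/
noncomputable def twoFormAct (j : E →L[ℝ] E) (β : E [⋀^Fin 2]→L[ℝ] ℝ) : E [⋀^Fin 2]→L[ℝ] ℝ :=
  (-(1 / 2) : ℝ) • β.compContinuousLinearMap (ContinuousLinearMap.id ℝ E + j)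

theorem twoFormAct_apply (hj : ∀ v, j (j v) = -v) {β : E [⋀^Fin 2]→L[ℝ] ℝ}
    (hβ : IsAntiInvariant j β) (v w : E) : twoFormAct j β ![v, w] = -β ![j v, w] := by
  simp only [twoFormAct, ContinuousAlternatingMap.smul_apply, compContinuousLinearMap_two,
    smul_eq_mul, _root_.add_apply, ContinuousLinearMap.id_apply, twoForm_add_left, twoForm_add_right]
  rw [hβ.apply_right hj, hβ]; ring

theorem IsAntiInvariant.act (hj : ∀ v, j (j v) = -v) {β : E [⋀^Fin 2]→L[ℝ] ℝ}
    (hβ : IsAntiInvariant j β) : IsAntiInvariant j (twoFormAct j β) := fun v w => by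
  rw [twoFormAct_apply hj hβ, twoFormAct_apply hj hβ, hβ]

theorem IsAntiInvariant.comb (hj : ∀ v, j (j v) = -v) {β : E [⋀^Fin 2]→L[ℝ] ℝ}
    (hβ : IsAntiInvariant j β) (p q : ℝ) : IsAntiInvariant j (p • β + q • twoFormAct j β) :=
  fun v w => by
    have := hβ.act hj v w
    simp only [ContinuousAlternatingMap.add_apply, ContinuousAlternatingMap.smul_apply, hβ v w,
      this, smul_eq_mul]
    ring

theorem twoFormAct_comb (hj : ∀ v, j (j v) = -v) {β : E [⋀^Fin 2]→L[ℝ] ℝ}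
    (hβ : IsAntiInvariant j β) (p q : ℝ) :
    twoFormAct j (p • β + q • twoFormAct j β) = p • twoFormAct j β - q • β := by
  refine twoForm_ext fun v w => ?_
  rw [twoFormAct_apply hj (hβ.comb hj p q)]
  simp only [ContinuousAlternatingMap.add_apply, ContinuousAlternatingMap.smul_apply,
    ContinuousAlternatingMap.sub_apply, twoFormAct_apply hj hβ, hj, twoForm_neg_left, smul_eq_mul]
  ring

/-- The coordinate carries the complex structure on forms to multiplication by `-i`. This is the
source of the combination `f - i g` and of the orientation by `(β, -Jβ)`. -/
theorem twoFormCoord_comb (hj : ∀ v, j (j v) = -v) {β : E [⋀^Fin 2]→L[ℝ] ℝ}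
    (hβ : IsAntiInvariant j β) (p q : ℝ) (a b : E) :
    twoFormCoord j a b (p • β + q • twoFormAct j β) =
      ((p : ℂ) - Complex.I * q) * twoFormCoord j a b β := by
  simp only [twoFormCoord, ContinuousAlternatingMap.add_apply, ContinuousAlternatingMap.smul_apply,
    twoFormAct_apply hj hβ, hj, twoForm_neg_left, smul_eq_mul]
  push_cast
  linear_combination (-q * β ![j a, b] : ℂ) * Complex.I_sq

theorem eq_comb_of_twoFormCoord (hd : Module.finrank ℝ E = 4) (hj : ∀ v, j (j v) = -v)
    {β γ : E [⋀^Fin 2]→L[ℝ] ℝ} (hβ : IsAntiInvariant j β) (hγ : IsAntiInvariant j γ) {a b : E}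
    (h : twoFormCoord j a b β ≠ 0) :
    γ = (twoFormCoord j a b γ / twoFormCoord j a b β).re • β +
      (-(twoFormCoord j a b γ / twoFormCoord j a b β).im) • twoFormAct j β := by
  set t := twoFormCoord j a b γ / twoFormCoord j a b β with ht
  rw [← sub_eq_zero]
  refine eq_zero_of_twoFormCoord_eq_zero hd hj (linearIndependent_of_twoFormCoord_ne_zero hj hβ h)
    (a := a) (b := b) (fun v w => ?_) ?_
  · rw [ContinuousAlternatingMap.sub_apply, ContinuousAlternatingMap.sub_apply, hγ,
      hβ.comb hj]; ring
  · rw [twoFormCoord_sub, twoFormCoord_comb hj hβ]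
    have : ((t.re : ℂ) - Complex.I * ((-t.im : ℝ) : ℂ)) = t := by
      apply Complex.ext <;> simp
    rw [this, ht, div_mul_cancel₀ _ h, sub_self]

theorem linearIndependent_twoFormAct (hj : ∀ v, j (j v) = -v) {β : E [⋀^Fin 2]→L[ℝ] ℝ}
    (hβ : IsAntiInvariant j β) (h : β ≠ 0) : LinearIndependent ℝ ![β, twoFormAct j β] := by
  obtain ⟨a, b, hab⟩ : ∃ a b, β ![a, b] ≠ 0 := by
    by_contra! h'
    exact h (twoForm_ext fun a b => h' a b)
  have hc : twoFormCoord j a b β ≠ 0 := fun h0 => hab (by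
    simpa [twoFormCoord] using congrArg Complex.re h0)
  refine LinearIndependent.pair_iff.2 fun p q hpq => ?_
  have h1 := twoFormCoord_comb hj hβ p q a b
  rw [hpq] at h1
  have h2 : ((p : ℂ) - Complex.I * q) = 0 := by
    refine (mul_eq_zero.1 (h1.symm.trans ?_)).resolve_right hc
    simp [twoFormCoord]
  exact ⟨by simpa using congrArg Complex.re h2, by simpa using congrArg Complex.im h2⟩

theorem exists_comb_of_isAntiInvariant (hd : Module.finrank ℝ E = 4) (hj : ∀ v, j (j v) = -v)
    {β γ : E [⋀^Fin 2]→L[ℝ] ℝ} (hβ : IsAntiInvariant j β) (h : β ≠ 0)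
    (hγ : IsAntiInvariant j γ) : ∃ p q : ℝ, p • β + q • twoFormAct j β = γ := by
  obtain ⟨a, b, hab⟩ : ∃ a b, β ![a, b] ≠ 0 := by
    by_contra! h'
    exact h (twoForm_ext fun a b => h' a b)
  have hc : twoFormCoord j a b β ≠ 0 := fun h0 => hab (by
    simpa [twoFormCoord] using congrArg Complex.re h0)
  exact ⟨_, _, (eq_comb_of_twoFormCoord hd hj hβ hγ hc).symm⟩

/-- Pullback intertwines the complex structures. -/
theorem twoFormAct_compContinuousLinearMap {E' : Type*} [AddCommGroup E'] [Module ℝ E']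
    [TopologicalSpace E'] [ContinuousAdd E'] {j' : E' →L[ℝ] E'} {L : E' →L[ℝ] E}
    (hL : ∀ v, L (j' v) = j (L v)) (β : E [⋀^Fin 2]→L[ℝ] ℝ) :
    twoFormAct j' (β.compContinuousLinearMap L) =
      (twoFormAct j β).compContinuousLinearMap L := by
  refine twoForm_ext fun v w => ?_
  simp only [twoFormAct, ContinuousAlternatingMap.smul_apply, compContinuousLinearMap_two,
    _root_.add_apply, ContinuousLinearMap.id_apply, map_add, hL]

end TwoFormAlgebra

/-! ### Differential calculus of 2-form valued maps -/

section TwoFormCalculus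

/-- A 2-form as a bilinear map. -/
noncomputable def twoFormBilin : (E4 [⋀^Fin 2]→L[ℝ] ℝ) →L[ℝ] (E4 →L[ℝ] E4 →L[ℝ] ℝ) :=
  (ContinuousLinearMap.compL ℝ E4 (E4 [⋀^Fin 1]→L[ℝ] ℝ) (E4 →L[ℝ] ℝ)
    ((ContinuousAlternatingMap.ofSubsingletonLIE (𝕜 := ℝ) (E := E4) (F := ℝ) (0 : Fin 1)).symm.toContinuousLinearEquiv :
      (E4 [⋀^Fin 1]→L[ℝ] ℝ) →L[ℝ] (E4 →L[ℝ] ℝ))).comp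
    (ContinuousAlternatingMap.curryLeftLI (𝕜 := ℝ) (E := E4) (F := ℝ) (n := 1)).toContinuousLinearMap

theorem twoFormBilin_apply (β : E4 [⋀^Fin 2]→L[ℝ] ℝ) (a b : E4) :
    twoFormBilin β a b = β ![a, b] := by
  show β (Matrix.vecCons a fun _ => b) = β ![a, b]
  congr 1
  ext i; fin_cases i <;> rfl

theorem twoFormBilin_injective : Function.Injective twoFormBilin := fun β γ h =>
  twoForm_ext fun a b => by rw [← twoFormBilin_apply, h, twoFormBilin_apply]

theorem exists_twoFormBilin_leftInverse :
    ∃ r : (E4 →L[ℝ] E4 →L[ℝ] ℝ) →L[ℝ] (E4 [⋀^Fin 2]→L[ℝ] ℝ), ∀ β, r (twoFormBilin β) = β := by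
  obtain ⟨g, hg⟩ := LinearMap.exists_leftInverse_of_injective (K := ℝ)
    (V := E4 [⋀^Fin 2]→L[ℝ] ℝ) (V' := E4 →L[ℝ] E4 →L[ℝ] ℝ)
    twoFormBilin.toLinearMap (LinearMap.ker_eq_bot.2 twoFormBilin_injective)
  have hg' : ∀ β, g (twoFormBilin β) = β := fun β => LinearMap.congr_fun hg β
  have hc : Continuous g := 
    LinearMap.continuous_of_finiteDimensional (E := E4 →L[ℝ] E4 →L[ℝ] ℝ) g
  exact ⟨⟨g, hc⟩, hg'⟩

/-- A continuous linear left inverse of `twoFormBilin`. -/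
noncomputable def twoFormOfBilin : (E4 →L[ℝ] E4 →L[ℝ] ℝ) →L[ℝ] (E4 [⋀^Fin 2]→L[ℝ] ℝ) :=
  exists_twoFormBilin_leftInverse.choose

theorem twoFormOfBilin_twoFormBilin (β : E4 [⋀^Fin 2]→L[ℝ] ℝ) :
    twoFormOfBilin (twoFormBilin β) = β :=
  exists_twoFormBilin_leftInverse.choose_spec β

/-- Exchange of the arguments of a bilinear map. -/
noncomputable def bilinFlip : (E4 →L[ℝ] E4 →L[ℝ] ℝ) →L[ℝ] (E4 →L[ℝ] E4 →L[ℝ] ℝ) :=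
  (ContinuousLinearMap.flipₗᵢ ℝ E4 E4 ℝ).toContinuousLinearEquiv

theorem contDiff_twoFormBilin {n : WithTop ℕ∞} : ContDiff ℝ n twoFormBilin := by fun_prop

theorem contDiff_bilinFlip {n : WithTop ℕ∞} : ContDiff ℝ n bilinFlip := by fun_prop

/-- Pullback becomes a chain of compositions and flips of continuous linear maps, so its regularity
in form and map jointly follows from the calculus of such maps. -/
theorem compContinuousLinearMap_eq_twoFormOfBilin (β : E4 [⋀^Fin 2]→L[ℝ] ℝ) (L : E4 →L[ℝ] E4) :
    β.compContinuousLinearMap L =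
      twoFormOfBilin ((((twoFormBilin β).comp L).flip.comp L).flip) := by
  rw [← twoFormOfBilin_twoFormBilin (β.compContinuousLinearMap L)]
  congr 1
  ext a b
  rw [twoFormBilin_apply, compContinuousLinearMap_two]
  exact (twoFormBilin_apply β (L a) (L b)).symm

variable {F : Type*} [NormedAddCommGroup F] [NormedSpace ℝ F]

theorem ContDiffOn.twoForm_comp {n : WithTop ℕ∞} {β : F → E4 [⋀^Fin 2]→L[ℝ] ℝ} {L : F → E4 →L[ℝ] E4}
    {s : Set F} (hβ : ContDiffOn ℝ n β s) (hL : ContDiffOn ℝ n L s) :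
    ContDiffOn ℝ n (fun x => (β x).compContinuousLinearMap (L x)) s := by
  simp only [compContinuousLinearMap_eq_twoFormOfBilin]
  have fl : ∀ {B : F → E4 →L[ℝ] E4 →L[ℝ] ℝ}, ContDiffOn ℝ n B s →
      ContDiffOn ℝ n (fun x => (B x).flip) s := fun {B} hB =>
    contDiff_bilinFlip.comp_contDiffOn hB
  exact twoFormOfBilin.contDiff.comp_contDiffOn
    (fl ((fl ((contDiff_twoFormBilin.comp_contDiffOn hβ).clm_comp hL)).clm_comp hL))

theorem ContinuousOn.twoForm_comp {X : Type*} [TopologicalSpace X] {β : X → E4 [⋀^Fin 2]→L[ℝ] ℝ}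
    {L : X → E4 →L[ℝ] E4} {s : Set X} (hβ : ContinuousOn β s) (hL : ContinuousOn L s) :
    ContinuousOn (fun x => (β x).compContinuousLinearMap (L x)) s := by
  simp only [compContinuousLinearMap_eq_twoFormOfBilin]
  have fl : ∀ {B : X → E4 →L[ℝ] E4 →L[ℝ] ℝ}, ContinuousOn B s →
      ContinuousOn (fun x => (B x).flip) s := fun {B} hB =>
    bilinFlip.continuous.comp_continuousOn hB
  exact twoFormOfBilin.continuous.comp_continuousOn
    (fl ((fl ((twoFormBilin.continuous.comp_continuousOn hβ).clm_comp hL)).clm_comp hL))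

theorem ContDiffOn.twoFormAct {n : WithTop ℕ∞} {β : F → E4 [⋀^Fin 2]→L[ℝ] ℝ} {L : F → E4 →L[ℝ] E4}
    {s : Set F} (hL : ContDiffOn ℝ n L s) (hβ : ContDiffOn ℝ n β s) :
    ContDiffOn ℝ n (fun x => twoFormAct (L x) (β x)) s :=
  (hβ.twoForm_comp (contDiffOn_const.add hL)).const_smul _

theorem ContDiffOn.twoForm_apply {n : WithTop ℕ∞} {β : F → E4 [⋀^Fin 2]→L[ℝ] ℝ} {a b : F → E4}
    {s : Set F} (hβ : ContDiffOn ℝ n β s) (ha : ContDiffOn ℝ n a s) (hb : ContDiffOn ℝ n b s) :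
    ContDiffOn ℝ n (fun x => β x ![a x, b x]) s := by
  simp only [← twoFormBilin_apply]
  exact ((contDiff_twoFormBilin.comp_contDiffOn hβ).clm_apply ha).clm_apply hb

theorem ContDiffOn.twoFormCoord {n : WithTop ℕ∞} {β : F → E4 [⋀^Fin 2]→L[ℝ] ℝ} {a b : F → E4}
    {L : F → E4 →L[ℝ] E4} {s : Set F} (hL : ContDiffOn ℝ n L s) (ha : ContDiffOn ℝ n a s)
    (hb : ContDiffOn ℝ n b s) (hβ : ContDiffOn ℝ n β s) :
    ContDiffOn ℝ n (fun x => twoFormCoord (L x) (a x) (b x) (β x)) s :=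
  (Complex.ofRealCLM.contDiff.comp_contDiffOn (hβ.twoForm_apply ha hb)).sub
    (contDiffOn_const.mul
      (Complex.ofRealCLM.contDiff.comp_contDiffOn (hβ.twoForm_apply (hL.clm_apply ha) hb)))

theorem HasFDerivAt.twoForm_apply {β : F → E4 [⋀^Fin 2]→L[ℝ] ℝ} {a b : F → E4}
    {β' : F →L[ℝ] E4 [⋀^Fin 2]→L[ℝ] ℝ} {a' b' : F →L[ℝ] E4} {x : F}
    (hβ : HasFDerivAt β β' x) (ha : HasFDerivAt a a' x) (hb : HasFDerivAt b b' x) :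
    ∃ T : F →L[ℝ] ℝ, HasFDerivAt (fun x => β x ![a x, b x]) T x ∧
      ∀ v, T v = β' v ![a x, b x] + β x ![a' v, b x] + β x ![a x, b' v] := by
  have h := hβ.continuousAlternatingMap_apply (g := ![a, b]) (g' := ![a', b'])
    (fun i => by fin_cases i <;> assumption)
  have e : ∀ x, (fun i => (![a, b] : Fin 2 → F → E4) i x) = ![a x, b x] := fun x => by
    ext i; fin_cases i <;> rfl
  simp only [e] at h
  refine ⟨_, h, fun v => ?_⟩
  have u0 : Function.update ![a x, b x] 0 (a' v) = ![a' v, b x] := by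
    ext i; fin_cases i <;> rfl
  have u1 : Function.update ![a x, b x] 1 (b' v) = ![a x, b' v] := by
    ext i; fin_cases i <;> rfl
  simp [Fin.sum_univ_two, u0, u1]
  ring

theorem extDeriv_two_apply {A : E4 → E4 [⋀^Fin 2]→L[ℝ] ℝ} {y : E4} (hA : DifferentiableAt ℝ A y)
    (a b c : E4) : extDeriv A y ![a, b, c] =
      fderiv ℝ A y a ![b, c] - fderiv ℝ A y b ![a, c] + fderiv ℝ A y c ![a, b] := by
  have h : ∀ v w x : E4, fderiv ℝ (fun x => A x ![v, w]) y x = fderiv ℝ A y x ![v, w] := by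
    intro v w x
    obtain ⟨T, hT, hT'⟩ := hA.hasFDerivAt.twoForm_apply (hasFDerivAt_const v y) (hasFDerivAt_const w y)
    have e1 := twoForm_smul_left (A y) 0 0 w
    have e2 := twoForm_smul_right (A y) 0 0 v
    simp only [smul_zero, zero_mul] at e1 e2
    rw [hT.fderiv, hT']
    simp [e1, e2]
  rw [extDeriv_apply hA, Fin.sum_univ_three]
  have r0 : (0 : Fin 3).removeNth ![a, b, c] = ![b, c] := by
    ext i; fin_cases i <;> rfl
  have r1 : (1 : Fin 3).removeNth ![a, b, c] = ![a, c] := by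
    ext i; fin_cases i <;> rfl
  have r2 : (2 : Fin 3).removeNth ![a, b, c] = ![a, b] := by
    ext i; fin_cases i <;> rfl
  rw [r0, r1, r2, h, h, h]
  simp
  ring

end TwoFormCalculus

/-! ### The Cauchy-Riemann inequality along a holomorphic curve -/

section HolomorphicCurve

theorem two_le_infty : (2 : WithTop ℕ∞) ≤ ∞ :=
  WithTop.coe_le_coe.2 (le_top : (2 : ℕ∞) ≤ ⊤)

/-- A smooth almost complex structure `J` on an open set `T` of `E4`, a closed `J`-anti-invariant
2-form `A` and a `J`-holomorphic map `u` into `T`. -/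
structure HolomorphicData (T : Set E4) (J : E4 → E4 →L[ℝ] E4) (A : E4 → E4 [⋀^Fin 2]→L[ℝ] ℝ)
    (Z : Set ℂ) (u : ℂ → E4) : Prop where
  isOpen_target : IsOpen T
  contDiffOn_J : ContDiffOn ℝ ∞ J T
  sq : ∀ y ∈ T, ∀ v, J y (J y v) = -v
  contDiffOn_form : ContDiffOn ℝ ∞ A T
  anti : ∀ y ∈ T, IsAntiInvariant (J y) (A y)
  closed : ∀ y ∈ T, extDeriv A y = 0
  isOpen_source : IsOpen Z
  contDiffOn_curve : ContDiffOn ℝ ∞ u Z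
  mapsTo : MapsTo u Z T
  holomorphic : ∀ z ∈ Z, ∀ v, fderiv ℝ u z (Complex.I * v) = J (u z) (fderiv ℝ u z v)

variable {T : Set E4} {J : E4 → E4 →L[ℝ] E4} {A : E4 → E4 [⋀^Fin 2]→L[ℝ] ℝ}
    {Z : Set ℂ} {u : ℂ → E4}

namespace HolomorphicData

theorem holomorphic_one (h : HolomorphicData T J A Z u) {z : ℂ} (hz : z ∈ Z) :
    J (u z) (fderiv ℝ u z 1) = fderiv ℝ u z Complex.I := by
  rw [← h.holomorphic z hz, mul_one]

/-- Differentiate the identity `A(X, JX) = 0` in the direction `v` with `X` constant. -/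
theorem fderiv_form_apply (h : HolomorphicData T J A Z u) {y : E4} (hy : y ∈ T) (X v : E4) :
    fderiv ℝ A y v ![X, J y X] = -A y ![X, fderiv ℝ J y v X] := by
  have hT := h.isOpen_target.mem_nhds hy
  have hA := ((h.contDiffOn_form.contDiffAt hT).differentiableAt (by simp)).hasFDerivAt
  have hJ := ((h.contDiffOn_J.contDiffAt hT).differentiableAt (by simp)).hasFDerivAt
  obtain ⟨D, hD, hDv⟩ := hA.twoForm_apply (hasFDerivAt_const X y)
    (hJ.clm_apply (hasFDerivAt_const X y))
  have h0 : (fun y => A y ![X, J y X]) =ᶠ[𝓝 y] fun _ => 0 := by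
    filter_upwards [hT] with y' hy' using (h.anti y' hy').apply_self (h.sq y' hy') X
  have hD0 : D = 0 := hD.unique ((hasFDerivAt_const 0 y).congr_of_eventuallyEq h0)
  have := hDv v
  have e1 := twoForm_smul_left (A y) 0 0 (J y X)
  simp only [smul_zero, zero_mul] at e1
  simp [hD0, e1] at this
  linarith

/-- The derivative of the contraction of the closed form with the tangent vectors of the curve and
a vector field `w` along it. -/
theorem contraction_deriv (h : HolomorphicData T J A Z u) {z : ℂ} (hz : z ∈ Z) {w : ℂ → E4}
    {w' : ℂ →L[ℝ] E4} (hw : HasFDerivAt w w' z) :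
    ∃ P Q : ℂ →L[ℝ] ℝ,
      HasFDerivAt (fun z => A (u z) ![fderiv ℝ u z 1, w z]) P z ∧
      HasFDerivAt (fun z => A (u z) ![fderiv ℝ u z Complex.I, w z]) Q z ∧
      P Complex.I - Q 1 = -A (u z) ![fderiv ℝ u z 1, fderiv ℝ J (u z) (w z) (fderiv ℝ u z 1)]
        + A (u z) ![fderiv ℝ u z 1, w' Complex.I] - A (u z) ![fderiv ℝ u z Complex.I, w' 1] := by
  have hZ := h.isOpen_source.mem_nhds hz
  have hT := h.isOpen_target.mem_nhds (h.mapsTo hz)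
  have hu := h.contDiffOn_curve.contDiffAt hZ
  have hA' := (h.contDiffOn_form.contDiffAt hT).differentiableAt (by simp)
  have hA : HasFDerivAt (fun z => A (u z)) ((fderiv ℝ A (u z)).comp (fderiv ℝ u z)) z :=
    hA'.hasFDerivAt.comp z (hu.differentiableAt (by simp)).hasFDerivAt
  have hdu : DifferentiableAt ℝ (fderiv ℝ u) z :=
    (hu.fderiv_right (m := 1) (by norm_cast)).differentiableAt (by simp)
  have hdu' : ∀ v, HasFDerivAt (fun z => fderiv ℝ u z v) ((fderiv ℝ (fderiv ℝ u) z).flip v) z :=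
    fun v => by
      refine (hdu.hasFDerivAt.clm_apply (hasFDerivAt_const v z)).congr_fderiv ?_
      ext; simp
  obtain ⟨P, hP, hPv⟩ := hA.twoForm_apply (hdu' 1) hw
  obtain ⟨Q, hQ, hQv⟩ := hA.twoForm_apply (hdu' Complex.I) hw
  refine ⟨P, Q, hP, hQ, ?_⟩
  -- Symmetry of the second derivative cancels the terms in which the tangent vectors of the curve
  -- are differentiated.
  have hsymm : fderiv ℝ (fderiv ℝ u) z Complex.I 1 = fderiv ℝ (fderiv ℝ u) z 1 Complex.I :=
    (hu.isSymmSndFDerivAt (by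
      rw [minSmoothness_of_isRCLikeNormedField]; exact two_le_infty)) _ _
  -- Closedness on `u_x, u_y, w` exchanges the derivatives of `A` along the curve for `(∂_w A)(u_x,
  -- u_y)`. Since `u_y = J u_x`, that term is of order zero in `A` by `fderiv_form_apply`.
  have hcl : extDeriv A (u z) ![fderiv ℝ u z 1, fderiv ℝ u z Complex.I, w z] = 0 := by
    rw [h.closed _ (h.mapsTo hz)]; rfl
  rw [extDeriv_two_apply hA'] at hcl
  have hJ := h.fderiv_form_apply (h.mapsTo hz) (fderiv ℝ u z 1) (w z)
  rw [h.holomorphic_one hz] at hJ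
  rw [hPv, hQv]
  simp only [ContinuousLinearMap.flip_apply, ContinuousLinearMap.comp_apply, hsymm]
  linarith

/-- The complex coordinate of the form along the curve, in the direction `b`. -/
noncomputable def curveCoord (J : E4 → E4 →L[ℝ] E4) (u : ℂ → E4) (b : E4)
    (B : E4 → E4 [⋀^Fin 2]→L[ℝ] ℝ) (z : ℂ) : ℂ :=
  twoFormCoord (J (u z)) (fderiv ℝ u z 1) b (B (u z))

theorem contDiffOn_comp (h : HolomorphicData T J A Z u) {G : Type*} [NormedAddCommGroup G]
    [NormedSpace ℝ G] {B : E4 → G} (hB : ContDiffOn ℝ ∞ B T) :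
    ContDiffOn ℝ ∞ (fun z => B (u z)) Z :=
  hB.comp h.contDiffOn_curve h.mapsTo

theorem contDiffOn_fderiv_apply (h : HolomorphicData T J A Z u) (v : ℂ) :
    ContDiffOn ℝ ∞ (fun z => fderiv ℝ u z v) Z :=
  (h.contDiffOn_curve.fderiv_of_isOpen h.isOpen_source (by norm_cast)).clm_apply contDiffOn_const

theorem contDiffOn_curveCoord (h : HolomorphicData T J A Z u) (b : E4)
    {B : E4 → E4 [⋀^Fin 2]→L[ℝ] ℝ} (hB : ContDiffOn ℝ ∞ B T) :
    ContDiffOn ℝ ∞ (curveCoord J u b B) Z :=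
  (h.contDiffOn_comp h.contDiffOn_J).twoFormCoord (h.contDiffOn_fderiv_apply 1) contDiffOn_const
    (h.contDiffOn_comp hB)

theorem norm_twoForm_le (β : E4 [⋀^Fin 2]→L[ℝ] ℝ) (a b : E4) :
    ‖β ![a, b]‖ ≤ ‖β‖ * (‖a‖ * ‖b‖) := by
  simpa [Fin.prod_univ_two] using β.le_opNorm ![a, b]

/-- With `p = A(u_x, b)` and `q = A(u_y, b)`, the operator yields `(p_x + q_y) + i (p_y - q_x)`. The
imaginary part is the expression of `contraction_deriv` for `w = b`, the real part the one for `w =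
J b`; both are linear in the value of `A`, with continuous coefficients. -/
theorem dbar_curveCoord_le (h : HolomorphicData T J A Z u) (b : E4) :
    ∃ N : ℂ → ℝ, ContinuousOn N Z ∧
      ∀ z ∈ Z, ‖dbar (curveCoord J u b A) z‖ ≤ ‖A (u z)‖ * N z := by
  set w : ℂ → E4 := fun z => J (u z) b with hw
  have hws : ContDiffOn ℝ ∞ w Z := (h.contDiffOn_comp h.contDiffOn_J).clm_apply contDiffOn_const
  have hdJ : ContDiffOn ℝ ∞ (fun z => fderiv ℝ J (u z)) Z :=
    h.contDiffOn_comp (h.contDiffOn_J.fderiv_of_isOpen h.isOpen_target (by norm_cast))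
  have hdw : ∀ v, ContDiffOn ℝ ∞ (fun z => fderiv ℝ w z v) Z := fun v =>
    (hws.fderiv_of_isOpen h.isOpen_source (by norm_cast)).clm_apply contDiffOn_const
  have hX := (h.contDiffOn_fderiv_apply 1).continuousOn
  have hY := (h.contDiffOn_fderiv_apply Complex.I).continuousOn
  refine ⟨fun z => ‖fderiv ℝ u z 1‖ * ‖fderiv ℝ J (u z) (w z) (fderiv ℝ u z 1)‖ +
      ‖fderiv ℝ u z 1‖ * ‖fderiv ℝ w z Complex.I‖ + ‖fderiv ℝ u z Complex.I‖ * ‖fderiv ℝ w z 1‖ +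
      ‖fderiv ℝ u z 1‖ * ‖fderiv ℝ J (u z) b (fderiv ℝ u z 1)‖, ?_, fun z hz => ?_⟩
  · refine (((hX.norm.mul ?_).add (hX.norm.mul (hdw _).continuousOn.norm)).add
      (hY.norm.mul (hdw _).continuousOn.norm)).add (hX.norm.mul ?_)
    · exact ((hdJ.continuousOn.clm_apply hws.continuousOn).clm_apply hX).norm
    · exact ((hdJ.continuousOn.clm_apply continuousOn_const).clm_apply hX).norm
  have hZ := h.isOpen_source.mem_nhds hz
  obtain ⟨P, Q, hP, hQ, hPQ⟩ := h.contraction_deriv hz (hasFDerivAt_const b z)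
  obtain ⟨P', Q', hP', hQ', hPQ'⟩ := h.contraction_deriv hz
    ((hws.contDiffAt hZ).differentiableAt (by simp)).hasFDerivAt
  -- Anti-invariance gives `A(u_y, J b) = -A(u_x, b)`, and below `A(u_x, J b) = A(u_y, b)`. Hence
  -- the contractions with `J b` are those with `b`, interchanged up to sign.
  have hQQ : Q' = -P := by
    refine hQ'.unique (hP.neg.congr_of_eventuallyEq ?_)
    filter_upwards [hZ] with z hz
    rw [hw, ← h.holomorphic_one hz]
    exact h.anti _ (h.mapsTo hz) _ _
  have hPP : P' = Q := by
    refine hP'.unique (hQ.congr_of_eventuallyEq ?_)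
    filter_upwards [hZ] with z hz
    rw [hw, ← h.holomorphic_one hz]
    exact (h.anti _ (h.mapsTo hz)).apply_right (h.sq _ (h.mapsTo hz)) _ _
  have hk : HasFDerivAt (curveCoord J u b A)
      (Complex.ofRealCLM.comp P - Complex.I • Complex.ofRealCLM.comp Q) z := by
    have h1 : HasFDerivAt (fun z => ((A (u z) ![fderiv ℝ u z 1, b] : ℝ) : ℂ))
        (Complex.ofRealCLM.comp P) z := Complex.ofRealCLM.hasFDerivAt.comp z hP
    have h2 : HasFDerivAt (fun z => ((A (u z) ![fderiv ℝ u z Complex.I, b] : ℝ) : ℂ))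
        (Complex.ofRealCLM.comp Q) z := Complex.ofRealCLM.hasFDerivAt.comp z hQ
    refine (h1.sub (h2.const_mul Complex.I)).congr_of_eventuallyEq ?_
    filter_upwards [hZ] with z hz
    simp only [curveCoord, twoFormCoord, h.holomorphic_one hz]
    rfl
  have hdb : dbar (curveCoord J u b A) z =
      ((P' Complex.I - Q' 1 : ℝ) : ℂ) + Complex.I * ((P Complex.I - Q 1 : ℝ) : ℂ) := by
    rw [dbar, hk.fderiv, hPP, hQQ]
    simp
    linear_combination (-(Q Complex.I : ℂ)) * Complex.I_sq
  have z0 : A (u z) ![fderiv ℝ u z 1, 0] = 0 := by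
    simpa using twoForm_smul_right (A (u z)) 0 0 (fderiv ℝ u z 1)
  have z1 : A (u z) ![fderiv ℝ u z Complex.I, 0] = 0 := by
    simpa using twoForm_smul_right (A (u z)) 0 0 (fderiv ℝ u z Complex.I)
  simp only [_root_.zero_apply, z0, z1, add_zero, sub_zero] at hPQ
  rw [hdb]
  refine (norm_add_le _ _).trans ?_
  rw [norm_mul, Complex.norm_I, one_mul, Complex.norm_real, Complex.norm_real, hPQ, hPQ', norm_neg]
  have n1 := norm_twoForm_le (A (u z)) (fderiv ℝ u z 1)
    (fderiv ℝ J (u z) (w z) (fderiv ℝ u z 1))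
  have n2 := norm_twoForm_le (A (u z)) (fderiv ℝ u z 1) (fderiv ℝ w z Complex.I)
  have n3 := norm_twoForm_le (A (u z)) (fderiv ℝ u z Complex.I) (fderiv ℝ w z 1)
  have n4 := norm_twoForm_le (A (u z)) (fderiv ℝ u z 1) (fderiv ℝ J (u z) b (fderiv ℝ u z 1))
  refine (add_le_add ((norm_sub_le _ _).trans (add_le_add ((norm_add_le _ _).trans
    (add_le_add ((norm_neg _).le.trans n1) n2)) n3)) n4).trans (le_of_eq ?_)
  ring

end HolomorphicData
end HolomorphicCurve

/-! ### Local frames and the factorization along the curve -/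

section LocalFrame

/-- Take `ρ = l ∧ m` with `l(a) ≠ 0`, `l(j a) = 0`, and `m` vanishing on `a` and `j a` but not on
`b`. Then `ρ(j a, j b) = 0`, while `ρ(a, b) = l(a) m(b)`. -/
theorem exists_twoForm_ne {E : Type*} [NormedAddCommGroup E] [NormedSpace ℝ E]
    [FiniteDimensional ℝ E] (hd : Module.finrank ℝ E = 4) {j : E →L[ℝ] E}
    (hj : ∀ v, j (j v) = -v) {a : E} (ha : a ≠ 0) :
    ∃ (b : E) (ρ : E [⋀^Fin 2]→L[ℝ] ℝ), ρ ![a, b] - ρ ![j a, j b] ≠ 0 := by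
  obtain ⟨l, hla, hlj⟩ : ∃ l : E →L[ℝ] ℝ, l a ≠ 0 ∧ l (j a) = 0 := by
    have hnm : a ∉ Submodule.span ℝ {j a} := fun h => by
      obtain ⟨t, ht⟩ := Submodule.mem_span_singleton.1 h
      have h1 := congrArg j ht
      rw [map_smul, hj] at h1
      have h2 : (t ^ 2 + 1) • a = 0 := by
        have h3 : t • (t • (-a)) = a := by rw [h1, ht]
        have h4 : (t ^ 2 + 1) • a = a - t • (t • (-a)) := by module
        rw [h4, h3, sub_self]
      exact ha ((smul_eq_zero.1 h2).resolve_left (by positivity))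
    obtain ⟨f, hf, hf'⟩ := Submodule.exists_le_ker_of_notMem hnm
    exact ⟨LinearMap.toContinuousLinearMap f, hf, by
      simpa using hf' (Submodule.mem_span_singleton_self _)⟩
  obtain ⟨b, hb⟩ : ∃ b, b ∉ Submodule.span ℝ {a, j a} := by
    by_contra! h
    have htop : Submodule.span ℝ {a, j a} = ⊤ := Submodule.eq_top_iff'.2 h
    classical
    have h1 := finrank_span_le_card (R := ℝ) ({a, j a} : Set E)
    rw [htop, finrank_top, hd, Set.toFinset_insert, Set.toFinset_singleton] at h1
    exact absurd (h1.trans Finset.card_le_two) (by norm_num)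
  obtain ⟨m, hm, hm'⟩ := Submodule.exists_le_ker_of_notMem hb
  have hma : m a = 0 := hm' (Submodule.subset_span (by simp))
  have hmj : m (j a) = 0 := hm' (Submodule.subset_span (by simp))
  refine ⟨b, wedgeTwo l (LinearMap.toContinuousLinearMap m), ?_⟩
  have e : ∀ x y, wedgeTwo l (LinearMap.toContinuousLinearMap m) ![x, y] = l x * m y - l y * m x :=
    fun x y => rfl
  rw [e, e, hma, hmj, hlj]
  simpa using ⟨hla, hm⟩

/-- Twice the anti-invariant part of a 2-form. -/
noncomputable def antiInvariantPart {E : Type*} [AddCommGroup E] [Module ℝ E] [TopologicalSpace E]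
    (j : E →L[ℝ] E) (ρ : E [⋀^Fin 2]→L[ℝ] ℝ) : E [⋀^Fin 2]→L[ℝ] ℝ :=
  ρ - ρ.compContinuousLinearMap j

theorem antiInvariantPart_apply {E : Type*} [AddCommGroup E] [Module ℝ E] [TopologicalSpace E]
    (j : E →L[ℝ] E) (ρ : E [⋀^Fin 2]→L[ℝ] ℝ) (a b : E) :
    antiInvariantPart j ρ ![a, b] = ρ ![a, b] - ρ ![j a, j b] := by
  rw [antiInvariantPart, ContinuousAlternatingMap.sub_apply, compContinuousLinearMap_two]

theorem isAntiInvariant_antiInvariantPart {E : Type*} [AddCommGroup E] [Module ℝ E]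
    [TopologicalSpace E] {j : E →L[ℝ] E} (hj : ∀ v, j (j v) = -v) (ρ : E [⋀^Fin 2]→L[ℝ] ℝ) :
    IsAntiInvariant j (antiInvariantPart j ρ) := fun v w => by
  rw [antiInvariantPart_apply, antiInvariantPart_apply, hj, hj, twoForm_neg_left, twoForm_neg_right]
  ring

theorem ContinuousAt.exists_le_add_one {X : Type*} [TopologicalSpace X] {f : X → ℝ} {x : X}
    (hf : ContinuousAt f x) : ∀ᶠ y in 𝓝 x, f y ≤ f x + 1 :=
  (hf.eventually (Iio_mem_nhds (lt_add_one (f x)))).mono fun _ h => le_of_lt h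

/-- Near a point of an immersed holomorphic curve, the coordinate of a closed anti-invariant form
with respect to a smooth frame is the product of a continuous nowhere zero function and a
holomorphic function along the curve. -/
theorem HolomorphicData.exists_local_frame {T : Set E4} {J : E4 → E4 →L[ℝ] E4}
    {A : E4 → E4 [⋀^Fin 2]→L[ℝ] ℝ} {Z : Set ℂ} {u : ℂ → E4} (h : HolomorphicData T J A Z u)
    {z₀ : ℂ} (hz₀ : z₀ ∈ Z) (hu0 : fderiv ℝ u z₀ 1 ≠ 0) :
    ∃ (V : Set E4) (η : E4 → E4 [⋀^Fin 2]→L[ℝ] ℝ) (q : E4 → ℂ) (r : ℝ) (F σ : ℂ → ℂ),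
      IsOpen V ∧ V ⊆ T ∧ u z₀ ∈ V ∧ ContDiffOn ℝ ∞ η V ∧ ContDiffOn ℝ ∞ q V ∧
      (∀ y ∈ V, IsAntiInvariant (J y) (η y) ∧ η y ≠ 0 ∧
        A y = (q y).re • η y + (-(q y).im) • twoFormAct (J y) (η y)) ∧
      0 < r ∧ Metric.ball z₀ r ⊆ Z ∧ MapsTo u (Metric.ball z₀ r) V ∧
      ContinuousOn F (Metric.ball z₀ r) ∧ (∀ z ∈ Metric.ball z₀ r, F z ≠ 0) ∧
      DifferentiableOn ℂ σ (Metric.ball z₀ r) ∧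
      ∀ z ∈ Metric.ball z₀ r, q (u z) = F z * σ z := by
  have hd : Module.finrank ℝ E4 = 4 := by simp [E4]
  set a := fderiv ℝ u z₀ 1 with ha
  obtain ⟨b, ρ, hρ⟩ := exists_twoForm_ne hd (h.sq _ (h.mapsTo hz₀)) hu0
  -- The constant form `ρ` is projected to its anti-invariant part at each point. This depends
  -- smoothly on `J`, and stays nonzero where the coordinate `D` does.
  set η : E4 → E4 [⋀^Fin 2]→L[ℝ] ℝ := fun y => antiInvariantPart (J y) ρ with hη
  have hηs : ContDiffOn ℝ ∞ η T := contDiffOn_const.sub (contDiffOn_const.twoForm_comp h.contDiffOn_J)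
  have hηa : ∀ y ∈ T, IsAntiInvariant (J y) (η y) := fun y hy =>
    isAntiInvariant_antiInvariantPart (h.sq y hy) ρ
  have hη0 : twoFormCoord (J (u z₀)) a b (η (u z₀)) ≠ 0 := fun h0 => hρ (by
    have := congrArg Complex.re h0
    simpa [twoFormCoord, hη, antiInvariantPart_apply] using this)
  set D : E4 → ℂ := fun y => twoFormCoord (J y) a b (η y) with hD
  have hDs : ContDiffOn ℝ ∞ D T := h.contDiffOn_J.twoFormCoord contDiffOn_const contDiffOn_const hηs
  set V : Set E4 := T ∩ D ⁻¹' {0}ᶜ with hV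
  have hVo : IsOpen V := hDs.continuousOn.isOpen_inter_preimage h.isOpen_target isOpen_compl_singleton
  have hVT : V ⊆ T := inter_subset_left
  have huV : u z₀ ∈ V := ⟨h.mapsTo hz₀, hη0⟩
  set q : E4 → ℂ := fun y => twoFormCoord (J y) a b (A y) / D y with hq
  have hqs : ContDiffOn ℝ ∞ q V := by
    simp only [hq, div_eq_mul_inv]
    exact ((h.contDiffOn_J.twoFormCoord contDiffOn_const contDiffOn_const
      h.contDiffOn_form).mono hVT).mul ((hDs.mono hVT).inv fun y hy => hy.2)
  have hframe : ∀ y ∈ V, A y = (q y).re • η y + (-(q y).im) • twoFormAct (J y) (η y) := fun y hy =>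
    eq_comb_of_twoFormCoord hd (h.sq y (hVT hy)) (hηa y (hVT hy)) (h.anti y (hVT hy)) hy.2
  have hηne : ∀ y ∈ V, η y ≠ 0 := fun y hy h0 => hy.2 (by simp [hD, h0, twoFormCoord])
  set m := curveCoord J u b η with hm
  set k := curveCoord J u b A with hk
  have hms : ContDiffOn ℝ ∞ m Z := h.contDiffOn_curveCoord b hηs
  have hks : ContDiffOn ℝ ∞ k Z := h.contDiffOn_curveCoord b h.contDiffOn_form
  have hZ := h.isOpen_source.mem_nhds hz₀
  have hcont : ContinuousAt u z₀ := (h.contDiffOn_curve.contDiffAt hZ).continuousAt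
  have hev : ∀ᶠ z in 𝓝 z₀, z ∈ Z ∧ u z ∈ V ∧ m z ≠ 0 := by
    have hZ' : ∀ᶠ z in 𝓝 z₀, z ∈ Z := hZ
    refine hZ'.and ((hcont.eventually (hVo.mem_nhds huV)).and ?_)
    exact (hms.continuousOn.continuousAt hZ).eventually_ne hη0
  obtain ⟨N, hNc, hN⟩ := h.dbar_curveCoord_le b
  -- The coefficient `q` does not depend on the vectors used to compute it, so the fixed `a` may be
  -- replaced by the moving tangent `u_x`, for which the Cauchy-Riemann inequality is known.
  have hkm : ∀ z, u z ∈ V → k z = q (u z) * m z := fun z hz => by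
    have := twoFormCoord_comb (h.sq _ (hVT hz)) (hηa _ (hVT hz)) (q (u z)).re (-(q (u z)).im)
      (fderiv ℝ u z 1) b
    rw [← hframe _ hz] at this
    rw [hk, curveCoord, this, hm, curveCoord]
    congr 1
    apply Complex.ext <;> simp
  -- This factor converts the bound by `‖A (u z)‖` into one by `‖k z‖`, using `A = Re q η - Im q Jη`
  -- and `q = k / m`.
  set N' : ℂ → ℝ := fun z => ‖m z‖⁻¹ * (‖η (u z)‖ + ‖twoFormAct (J (u z)) (η (u z))‖) * |N z| with hN'
  have hN'c : ContinuousAt N' z₀ := by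
    have h1 : ContinuousAt (fun z => ‖η (u z)‖) z₀ :=
      ((h.contDiffOn_comp hηs).continuousOn.continuousAt hZ).norm
    have h2 : ContinuousAt (fun z => ‖twoFormAct (J (u z)) (η (u z))‖) z₀ :=
      ((h.contDiffOn_comp (h.contDiffOn_J.twoFormAct hηs)).continuousOn.continuousAt hZ).norm
    exact (((hms.continuousOn.continuousAt hZ).norm.inv₀ (norm_ne_zero_iff.2 hη0)).mul
      (h1.add h2)).mul (hNc.continuousAt hZ).abs
  have hN'0 : 0 ≤ N' z₀ := by positivity
  obtain ⟨R, hR, hball⟩ := Metric.eventually_nhds_iff_ball.1 (hev.and hN'c.exists_le_add_one)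
  have hbound : ∀ z ∈ Metric.ball z₀ R, ‖dbar k z‖ ≤ (N' z₀ + 1) * ‖k z‖ := fun z hz => by
    obtain ⟨⟨hzZ, hzV, hmz⟩, hle⟩ := hball z hz
    have hA : ‖A (u z)‖ ≤ ‖q (u z)‖ * (‖η (u z)‖ + ‖twoFormAct (J (u z)) (η (u z))‖) := by
      conv_lhs => rw [hframe _ hzV]
      refine (norm_add_le _ _).trans ?_
      rw [norm_smul, norm_smul, norm_neg, mul_add]
      gcongr
      · exact Complex.abs_re_le_norm _
      · exact Complex.abs_im_le_norm _
    have hqk : ‖q (u z)‖ = ‖k z‖ * ‖m z‖⁻¹ := by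
      rw [hkm z hzV, norm_mul, mul_inv_cancel_right₀ (norm_ne_zero_iff.2 hmz)]
    calc ‖dbar k z‖ ≤ ‖A (u z)‖ * N z := hN z hzZ
      _ ≤ ‖A (u z)‖ * |N z| := by gcongr; exact le_abs_self _
      _ ≤ ‖q (u z)‖ * (‖η (u z)‖ + ‖twoFormAct (J (u z)) (η (u z))‖) * |N z| := by gcongr
      _ = N' z * ‖k z‖ := by rw [hqk, hN']; ring
      _ ≤ (N' z₀ + 1) * ‖k z‖ := by gcongr
  have hBZ : Metric.ball z₀ R ⊆ Z := fun z hz => (hball z hz).1.1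
  obtain ⟨r, hr, hrR, s, σ, hs, hσ, hsσ⟩ := exists_exp_mul_holomorphic hR (by positivity)
    ((hks.mono hBZ).of_le two_le_infty) hbound
  have hrR' : Metric.ball z₀ r ⊆ Metric.ball z₀ R := Metric.ball_subset_ball hrR
  have hm0 : ∀ z ∈ Metric.ball z₀ r, m z ≠ 0 := fun z hz => (hball z (hrR' hz)).1.2.2
  refine ⟨V, η, q, r, fun z => Complex.exp (s z) / m z, σ, hVo, hVT, huV, hηs.mono hVT, hqs,
    fun y hy => ⟨hηa y (hVT hy), hηne y hy, hframe y hy⟩, hr, hrR'.trans hBZ,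
    fun z hz => (hball z (hrR' hz)).1.2.1,
    hs.cexp.div (hms.continuousOn.mono (hrR'.trans hBZ)) hm0,
    fun z hz => div_ne_zero (Complex.exp_ne_zero _) (hm0 z hz), hσ, fun z hz => ?_⟩
  have h1 := hsσ z hz
  rw [hkm z (hball z (hrR' hz)).1.2.1] at h1
  rw [div_mul_eq_mul_div, ← h1, mul_div_cancel_right₀ _ (hm0 z hz)]

end LocalFrame

/-! ### Passage between the manifold and its charts -/

section ChartTransfer

variable {M : Type*} [TopologicalSpace M] [ChartedSpace E4 M]

/-- The derivative of the chart at `c`. -/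
noncomputable def chartDeriv (c x : M) : TangentSpace (𝓡 4) x →L[ℝ] E4 :=
  mfderiv (𝓡 4) 𝓘(ℝ, E4) (extChartAt (𝓡 4) c) x

/-- The derivative of the inverse of the chart at `c`. -/
noncomputable def chartSymmDeriv (c : M) (y : E4) :
    E4 →L[ℝ] TangentSpace (𝓡 4) ((extChartAt (𝓡 4) c).symm y) :=
  mfderiv 𝓘(ℝ, E4) (𝓡 4) (extChartAt (𝓡 4) c).symm y

variable [IsManifold (𝓡 4) ∞ M]

theorem chartDeriv_chartSymmDeriv {c : M} {y : E4} (hy : y ∈ (extChartAt (𝓡 4) c).target) (v : E4) :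
    chartDeriv c ((extChartAt (𝓡 4) c).symm y) (chartSymmDeriv c y v) = v := by
  have : IsManifold (𝓡 4) 1 M := IsManifold.of_le (n := ∞) (by norm_cast)
  have h := mfderiv_extChartAt_comp_mfderivWithin_extChartAt_symm (I := 𝓡 4) hy
  rw [ModelWithCorners.range_eq_univ, mfderivWithin_univ] at h
  exact DFunLike.congr_fun h v

theorem chartSymmDeriv_chartDeriv {c : M} {y : E4} (hy : y ∈ (extChartAt (𝓡 4) c).target)
    (v : TangentSpace (𝓡 4) ((extChartAt (𝓡 4) c).symm y)) :
    chartSymmDeriv c y (chartDeriv c ((extChartAt (𝓡 4) c).symm y) v) = v := by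
  have : IsManifold (𝓡 4) 1 M := IsManifold.of_le (n := ∞) (by norm_cast)
  have h := mfderivWithin_extChartAt_symm_comp_mfderiv_extChartAt (I := 𝓡 4) hy
  rw [ModelWithCorners.range_eq_univ, mfderivWithin_univ] at h
  exact DFunLike.congr_fun h v

namespace AlmostComplexStructure

/-- The almost complex structure in the chart at `c`. -/
noncomputable def inChart (J : AlmostComplexStructure M) (c : M) (y : E4) : E4 →L[ℝ] E4 :=
  (chartDeriv c ((extChartAt (𝓡 4) c).symm y)).comp
    ((J.toFun ((extChartAt (𝓡 4) c).symm y)).comp (chartSymmDeriv c y))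

theorem inChart_chartDeriv (J : AlmostComplexStructure M) {c : M} {y : E4}
    (hy : y ∈ (extChartAt (𝓡 4) c).target)
    (v : TangentSpace (𝓡 4) ((extChartAt (𝓡 4) c).symm y)) :
    chartDeriv c _ (J.toFun _ v) = J.inChart c y (chartDeriv c _ v) := by
  rw [inChart, ContinuousLinearMap.comp_apply, ContinuousLinearMap.comp_apply,
    chartSymmDeriv_chartDeriv hy]

theorem inChart_chartDeriv' (J : AlmostComplexStructure M) {c x : M}
    (hx : x ∈ (extChartAt (𝓡 4) c).source) (v : TangentSpace (𝓡 4) x) :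
    chartDeriv c x (J.toFun x v) = J.inChart c (extChartAt (𝓡 4) c x) (chartDeriv c x v) := by
  have h := fun v => J.inChart_chartDeriv ((extChartAt (𝓡 4) c).map_source hx) (v := v)
  rw [(extChartAt (𝓡 4) c).left_inv hx] at h
  exact h v

theorem chartSymmDeriv_inChart (J : AlmostComplexStructure M) {c : M} {y : E4}
    (hy : y ∈ (extChartAt (𝓡 4) c).target) (v : E4) :
    chartSymmDeriv c y (J.inChart c y v) = J.toFun _ (chartSymmDeriv c y v) := by
  rw [inChart, ContinuousLinearMap.comp_apply, ContinuousLinearMap.comp_apply,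
    chartSymmDeriv_chartDeriv hy]

theorem inChart_sq (J : AlmostComplexStructure M) {c : M} {y : E4}
    (hy : y ∈ (extChartAt (𝓡 4) c).target) (v : E4) :
    J.inChart c y (J.inChart c y v) = -v := by
  show chartDeriv c _ (J.toFun _ (chartSymmDeriv c y (J.inChart c y v))) = -v
  rw [J.chartSymmDeriv_inChart hy,
    J.sq, map_neg, chartDeriv_chartSymmDeriv hy]

/-- The trivialization of the endomorphism bundle at `c` conjugates by the derivative of the chart,
so the bundle notion of smoothness for `J` is smoothness of this coordinate expression. -/
theorem contDiffOn_inChart (J : AlmostComplexStructure M) (c : M) :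
    ContDiffOn ℝ ∞ (J.inChart c) (extChartAt (𝓡 4) c).target := by
  have : IsManifold (𝓡 4) 1 M := IsManifold.of_le (n := ∞) (by norm_cast)
  have : IsManifold (𝓡 4) (∞ + 1) M := inferInstanceAs (IsManifold (𝓡 4) ∞ M)
  set e := trivializationAt (E4 →L[ℝ] E4)
    (fun x : M => TangentSpace (𝓡 4) x →L[ℝ] TangentSpace (𝓡 4) x) c with he
  have h1 := (e.contMDiffOn_section_baseSet_iff (IB := 𝓡 4) (n := ∞)
    (s := fun x => J.toFun x)).1 J.smooth.contMDiffOn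
  rw [← contMDiffOn_iff_contDiffOn]
  have h2 := h1.comp (contMDiffOn_extChartAt_symm (I := 𝓡 4) (n := ∞) c) (by
    intro y hy
    have := (extChartAt (𝓡 4) c).map_target hy
    rw [extChartAt_source] at this
    exact ⟨this, this⟩)
  refine h2.congr fun y hy => ?_
  have hs := (extChartAt (𝓡 4) c).map_target hy
  rw [extChartAt_source] at hs
  have h3 := inTangentCoordinates_eq_mfderiv_comp (I := 𝓡 4) (I' := 𝓡 4) (f := fun x : M => x)
    (g := fun x : M => x) (ϕ := fun x => J.toFun x) (x₀ := c) (x := (extChartAt (𝓡 4) c).symm y) hs hs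
  rw [(extChartAt (𝓡 4) c).right_inv hy, ModelWithCorners.range_eq_univ, mfderivWithin_univ] at h3
  exact h3.symm

theorem isAntiInvariant_inChart (J : AlmostComplexStructure M) {α : TwoForm M}
    (hα : ∀ x, α x ∈ J.antiInvariant x) {c : M} {y : E4} (hy : y ∈ (extChartAt (𝓡 4) c).target) :
    IsAntiInvariant (J.inChart c y) (α.inChart c y) :=
  IsAntiInvariant.compContinuousLinearMap (j := J.toFun _) (L := chartSymmDeriv c y)
    (J.chartSymmDeriv_inChart hy) (hα _)

end AlmostComplexStructure

/-- The 2-form with a given expression in the chart at `c`. -/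
noncomputable def TwoForm.ofChart (c : M) (η : E4 → E4 [⋀^Fin 2]→L[ℝ] ℝ) : TwoForm M := fun x =>
  (η (extChartAt (𝓡 4) c x)).compContinuousLinearMap (chartDeriv c x)

theorem TwoForm.ofChart_inChart (α : TwoForm M) {c x : M}
    (hx : x ∈ (extChartAt (𝓡 4) c).source) : TwoForm.ofChart c (α.inChart c) x = α x := by
  have h : ∀ y ∈ (extChartAt (𝓡 4) c).target,
      ((α.inChart c) y).compContinuousLinearMap (chartDeriv c ((extChartAt (𝓡 4) c).symm y)) =
        α ((extChartAt (𝓡 4) c).symm y) := fun y hy => by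
    refine twoForm_ext fun a b => ?_
    rw [compContinuousLinearMap_two, TwoForm.inChart]
    refine (compContinuousLinearMap_two _ (chartSymmDeriv c y) _ _).trans ?_
    rw [chartSymmDeriv_chartDeriv hy, chartSymmDeriv_chartDeriv hy]
  have h1 := h _ ((extChartAt (𝓡 4) c).map_source hx)
  rw [(extChartAt (𝓡 4) c).left_inv hx] at h1
  exact h1

section Transition

variable (c c' : M)

/-- The domain of the transition map from the chart at `c'` to the chart at `c`. -/
def transitionDomain : Set E4 := chartDomain c' (extChartAt (𝓡 4) c).source

omit [IsManifold (𝓡 4) ∞ M] in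
theorem isOpen_transitionDomain : IsOpen (transitionDomain c c') :=
  (continuousOn_extChartAt_symm c').isOpen_inter_preimage (isOpen_extChartAt_target c')
    (isOpen_extChartAt_source c)

theorem contDiffOn_transition : ContDiffOn ℝ ∞
    (fun y => extChartAt (𝓡 4) c ((extChartAt (𝓡 4) c').symm y)) (transitionDomain c c') := by
  rw [← contMDiffOn_iff_contDiffOn]
  refine (contMDiffOn_extChartAt (I := 𝓡 4) (n := ∞) (x := c)).comp
    ((contMDiffOn_extChartAt_symm (I := 𝓡 4) (n := ∞) c').mono inter_subset_left) fun y hy => ?_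
  have := hy.2
  rwa [mem_preimage, extChartAt_source] at this

theorem TwoForm.inChart_ofChart {y : E4} (hy : y ∈ transitionDomain c c')
    (η : E4 → E4 [⋀^Fin 2]→L[ℝ] ℝ) : (TwoForm.ofChart c η).inChart c' y =
      (η (extChartAt (𝓡 4) c ((extChartAt (𝓡 4) c').symm y))).compContinuousLinearMap
        (fderiv ℝ (fun y => extChartAt (𝓡 4) c ((extChartAt (𝓡 4) c').symm y)) y) := by
  have hs := hy.2
  rw [mem_preimage, extChartAt_source] at hs
  have h1 : MDifferentiableAt (𝓡 4) 𝓘(ℝ, E4) (extChartAt (𝓡 4) c) ((extChartAt (𝓡 4) c').symm y) :=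
    (contMDiffAt_extChartAt' (n := ∞) hs).mdifferentiableAt (by simp)
  have h2 : MDifferentiableAt 𝓘(ℝ, E4) (𝓡 4) (extChartAt (𝓡 4) c').symm y :=
    ((contMDiffOn_extChartAt_symm (n := ∞) c').contMDiffAt
      ((isOpen_extChartAt_target c').mem_nhds hy.1)).mdifferentiableAt (by simp)
  have h3 := mfderiv_comp y h1 h2
  rw [mfderiv_eq_fderiv] at h3
  refine twoForm_ext fun a b => ?_
  rw [compContinuousLinearMap_two]
  refine (compContinuousLinearMap_two _ (chartSymmDeriv c' y) _ _).trans ?_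
  refine (compContinuousLinearMap_two _ (chartDeriv c _) _ _).trans ?_
  have h4 : ∀ v, chartDeriv c _ (chartSymmDeriv c' y v) =
    fderiv ℝ (fun y => extChartAt (𝓡 4) c ((extChartAt (𝓡 4) c').symm y)) y v :=
    fun v => (DFunLike.congr_fun h3 v).symm
  rw [h4, h4]

end Transition

theorem TwoForm.isSmoothOn_ofChart {c : M} {U : Set M} (hU : U ⊆ (extChartAt (𝓡 4) c).source)
    {S : Set E4} {η : E4 → E4 [⋀^Fin 2]→L[ℝ] ℝ} (hη : ContDiffOn ℝ ∞ η S)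
    (hUS : MapsTo (extChartAt (𝓡 4) c) U S) : (TwoForm.ofChart c η).IsSmoothOn U := fun c' => by
  have hsub : chartDomain c' U ⊆ transitionDomain c c' := fun y hy => ⟨hy.1, hU hy.2⟩
  have hd := (contDiffOn_transition c c').fderiv_of_isOpen (isOpen_transitionDomain c c')
    (m := ∞) (by norm_cast)
  refine ((hη.comp ((contDiffOn_transition c c').mono hsub) fun y hy => hUS hy.2).twoForm_comp
    (hd.mono hsub)).congr fun y hy => TwoForm.inChart_ofChart c c' (hsub hy) η

theorem TwoForm.isContinuousOn_ofChart {c : M} {U : Set M} (hU : U ⊆ (extChartAt (𝓡 4) c).source)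
    {S : Set E4} {η : E4 → E4 [⋀^Fin 2]→L[ℝ] ℝ} (hη : ContinuousOn η S)
    (hUS : MapsTo (extChartAt (𝓡 4) c) U S) : (TwoForm.ofChart c η).IsContinuousOn U := fun c' => by
  have hsub : chartDomain c' U ⊆ transitionDomain c c' := fun y hy => ⟨hy.1, hU hy.2⟩
  have hd := (contDiffOn_transition c c').fderiv_of_isOpen (isOpen_transitionDomain c c')
    (m := ∞) (by norm_cast)
  refine ((hη.comp ((contDiffOn_transition c c').continuousOn.mono hsub)
    fun y hy => hUS hy.2).twoForm_comp
    (hd.continuousOn.mono hsub)).congr fun y hy => TwoForm.inChart_ofChart c c' (hsub hy) η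

namespace AlmostComplexStructure

theorem act_ofChart (J : AlmostComplexStructure M) {c x : M}
    (hx : x ∈ (extChartAt (𝓡 4) c).source) (η : E4 → E4 [⋀^Fin 2]→L[ℝ] ℝ) :
    J.act (TwoForm.ofChart c η x) =
      TwoForm.ofChart c (fun y => twoFormAct (J.inChart c y) (η y)) x :=
  twoFormAct_compContinuousLinearMap (J.inChart_chartDeriv' hx) _

/-- The fibres are complex lines, so a nowhere zero anti-invariant form is enough. Nonvanishing
passes to the manifold because the derivative of the chart is surjective. -/
theorem isFrameOn_ofChart (J : AlmostComplexStructure M) {c : M} {U : Set M}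
    (hU : U ⊆ (extChartAt (𝓡 4) c).source) {η : E4 → E4 [⋀^Fin 2]→L[ℝ] ℝ}
    (hη : ∀ x ∈ U, IsAntiInvariant (J.inChart c (extChartAt (𝓡 4) c x)) (η (extChartAt (𝓡 4) c x)))
    (hη0 : ∀ x ∈ U, η (extChartAt (𝓡 4) c x) ≠ 0) : J.IsFrameOn (TwoForm.ofChart c η) U := by
  intro x hx
  have hxs := hU hx
  have ha : IsAntiInvariant (J.toFun x) (TwoForm.ofChart c η x) :=
    (hη x hx).compContinuousLinearMap (J.inChart_chartDeriv' hxs)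
  have hsurj : Function.Surjective (chartDeriv c x) := by
    have h := fun v => chartDeriv_chartSymmDeriv ((extChartAt (𝓡 4) c).map_source hxs) v
    have h' : Function.Surjective
      (chartDeriv c ((extChartAt (𝓡 4) c).symm (extChartAt (𝓡 4) c x))) := fun v => ⟨_, h v⟩
    rwa [(extChartAt (𝓡 4) c).left_inv hxs] at h'
  have hne : TwoForm.ofChart c η x ≠ 0 := fun h0 => hη0 x hx <| twoForm_ext fun a b => by
    obtain ⟨a, rfl⟩ := hsurj a
    obtain ⟨b, rfl⟩ := hsurj b
    have := congrArg (fun β => β ![a, b]) h0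
    rw [← compContinuousLinearMap_two]
    exact this
  have hd : Module.finrank ℝ (TangentSpace (𝓡 4) x) = 4 := by
    show Module.finrank ℝ E4 = 4
    simp [E4]
  refine ⟨linearIndependent_twoFormAct (J.sq x) ha hne, le_antisymm ?_ fun γ hγ => ?_⟩
  · rw [Submodule.span_le]
    rintro β (rfl | rfl)
    · exact ha
    · exact ha.act (J.sq x)
  · obtain ⟨p, q, hpq⟩ := exists_comb_of_isAntiInvariant hd (J.sq x) ha hne hγ
    exact Submodule.mem_span_pair.2 ⟨p, q, hpq⟩

end AlmostComplexStructure

end ChartTransfer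

/-! ### The holomorphic disk in a chart -/

section CurveInChart

variable {M : Type*} [TopologicalSpace M] [ChartedSpace E4 M] [IsManifold (𝓡 4) ∞ M]

namespace AlmostComplexStructure

variable {J : AlmostComplexStructure M} {u : ℂ → M}

theorem isOpen_disk : IsOpen disk := Metric.isOpen_ball

theorem IsEmbeddedHolomorphicDisk.isOpen_preimage (hu : J.IsEmbeddedHolomorphicDisk u) {O : Set M}
    (hO : IsOpen O) : IsOpen (disk ∩ u ⁻¹' O) :=
  hu.smooth.continuousOn.isOpen_inter_preimage isOpen_disk hO

theorem IsEmbeddedHolomorphicDisk.hasFDerivAt_inChart (hu : J.IsEmbeddedHolomorphicDisk u) {c : M}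
    {z : ℂ} (hz : z ∈ disk ∩ u ⁻¹' (extChartAt (𝓡 4) c).source) (v : ℂ) :
    fderiv ℝ (fun z => extChartAt (𝓡 4) c (u z)) z v =
      chartDeriv c (u z) (mfderiv 𝓘(ℝ, ℂ) (𝓡 4) u z v) := by
  have hs := hz.2
  rw [mem_preimage, extChartAt_source] at hs
  have h1 : MDifferentiableAt (𝓡 4) 𝓘(ℝ, E4) (extChartAt (𝓡 4) c) (u z) :=
    (contMDiffAt_extChartAt' (n := ∞) hs).mdifferentiableAt (by simp)
  have h2 : MDifferentiableAt 𝓘(ℝ, ℂ) (𝓡 4) u z :=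
    (hu.smooth.contMDiffAt (isOpen_disk.mem_nhds hz.1)).mdifferentiableAt (by simp)
  have h3 := mfderiv_comp z h1 h2
  rw [mfderiv_eq_fderiv] at h3
  exact DFunLike.congr_fun h3 v

theorem IsEmbeddedHolomorphicDisk.holomorphicData (hu : J.IsEmbeddedHolomorphicDisk u)
    {α : TwoForm M} (hα : α.IsSmoothOn univ) (hanti : ∀ x, α x ∈ J.antiInvariant x)
    (hclosed : α.IsClosedForm) (c : M) :
    HolomorphicData (extChartAt (𝓡 4) c).target (J.inChart c) (α.inChart c)
      (disk ∩ u ⁻¹' (extChartAt (𝓡 4) c).source) (fun z => extChartAt (𝓡 4) c (u z)) where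
  isOpen_target := isOpen_extChartAt_target c
  contDiffOn_J := J.contDiffOn_inChart c
  sq y hy := J.inChart_sq hy
  contDiffOn_form := (hα c).mono fun y hy => ⟨hy, trivial⟩
  anti y hy := J.isAntiInvariant_inChart hanti hy
  closed := hclosed c
  isOpen_source := hu.isOpen_preimage (isOpen_extChartAt_source c)
  contDiffOn_curve := by
    rw [← contMDiffOn_iff_contDiffOn]
    refine (contMDiffOn_extChartAt (I := 𝓡 4) (n := ∞) (x := c)).comp
      (hu.smooth.mono inter_subset_left) fun z hz => ?_
    have := hz.2
    rwa [mem_preimage, extChartAt_source] at this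
  mapsTo z hz := (extChartAt (𝓡 4) c).map_source hz.2
  holomorphic z hz v := by
    rw [hu.hasFDerivAt_inChart hz, hu.hasFDerivAt_inChart hz, hu.holomorphic z hz.1,
      J.inChart_chartDeriv' hz.2]

theorem IsEmbeddedHolomorphicDisk.injective_fderiv_inChart (hu : J.IsEmbeddedHolomorphicDisk u)
    {c : M} {z : ℂ} (hz : z ∈ disk ∩ u ⁻¹' (extChartAt (𝓡 4) c).source) :
    Function.Injective (fderiv ℝ (fun z => extChartAt (𝓡 4) c (u z)) z) := by
  intro v w hvw
  rw [hu.hasFDerivAt_inChart hz, hu.hasFDerivAt_inChart hz] at hvw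
  refine hu.immersion z hz.1 ?_
  have h : Function.Injective (chartDeriv c (u z)) := by
    have h : Function.Injective
        (chartDeriv c ((extChartAt (𝓡 4) c).symm (extChartAt (𝓡 4) c (u z)))) :=
      fun a b hab => by
        have h1 := chartSymmDeriv_chartDeriv ((extChartAt (𝓡 4) c).map_source hz.2)
        rw [← h1 a, hab, h1 b]
    rwa [(extChartAt (𝓡 4) c).left_inv hz.2] at h
  exact h hvw

/-- Here the embedding property enters: the disk has the topology induced by `u`. An injective
immersion could return arbitrarily close to `u 0` far from the centre, where holomorphy of the
coefficient is not controlled. -/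
theorem IsEmbeddedHolomorphicDisk.exists_preimage_subset_ball (hu : J.IsEmbeddedHolomorphicDisk u)
    {r : ℝ} (hr : 0 < r) :
    ∃ O : Set M, IsOpen O ∧ u 0 ∈ O ∧ disk ∩ u ⁻¹' O ⊆ Metric.ball 0 r := by
  have h0 : (0 : ℂ) ∈ disk := by simp [disk]
  have h1 : Subtype.val ⁻¹' Metric.ball (0 : ℂ) r ∈ 𝓝 (⟨0, h0⟩ : disk) :=
    continuous_subtype_val.continuousAt.preimage_mem_nhds (Metric.ball_mem_nhds _ hr)
  rw [hu.embedding.isInducing.nhds_eq_comap] at h1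
  obtain ⟨t, ht, hts⟩ := h1
  obtain ⟨O, hOt, hO, h0O⟩ := mem_nhds_iff.1 ht
  exact ⟨O, hO, h0O, fun z hz => hts (a := ⟨z, hz.1⟩) (hOt hz.2)⟩

end AlmostComplexStructure

end CurveInChart

/-! ### Extending functions from the curve to the ambient space -/

section Extension

/-- If `P` is a linear left inverse of `du` at `z₀`, then `P ∘ u` is a local diffeomorphism by the
inverse function theorem, and `ρ = (P ∘ u)⁻¹ ∘ P` inverts `u` near `z₀`. -/
theorem exists_smooth_retraction {u : ℂ → E4} {Z : Set ℂ} (hZ : IsOpen Z) (hu : ContDiffOn ℝ ∞ u Z)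
    {z₀ : ℂ} (hz₀ : z₀ ∈ Z) (hinj : Function.Injective (fderiv ℝ u z₀)) {δ : ℝ} (hδ : 0 < δ) :
    ∃ (S : Set E4) (ρ : E4 → ℂ), IsOpen S ∧ u z₀ ∈ S ∧ ContDiffOn ℝ ∞ ρ S ∧
      MapsTo ρ S (Metric.ball z₀ δ ∩ Z) ∧ ∀ᶠ z in 𝓝 z₀, ρ (u z) = z := by
  obtain ⟨P, hP⟩ : ∃ P : E4 →L[ℝ] ℂ, ∀ v, P (fderiv ℝ u z₀ v) = v := by
    obtain ⟨g, hg⟩ := LinearMap.exists_leftInverse_of_injective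
      (fderiv ℝ u z₀).toLinearMap (LinearMap.ker_eq_bot.2 hinj)
    exact ⟨LinearMap.toContinuousLinearMap g, fun v => LinearMap.congr_fun hg v⟩
  set f : ℂ → ℂ := fun z => P (u z) with hf
  have hfs : ContDiffOn ℝ ∞ f Z := P.contDiff.comp_contDiffOn hu
  have hfa : ∀ z ∈ Z, ContDiffAt ℝ ∞ f z := fun z hz => hfs.contDiffAt (hZ.mem_nhds hz)
  have hfd : fderiv ℝ f z₀ = (ContinuousLinearEquiv.refl ℝ ℂ : ℂ →L[ℝ] ℂ) := by
    have h1 := P.hasFDerivAt.comp z₀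
      ((hu.contDiffAt (hZ.mem_nhds hz₀)).differentiableAt (by simp)).hasFDerivAt
    refine h1.fderiv.trans ?_
    ext
    all_goals simp [hP]
  have hfd' : HasFDerivAt f ((ContinuousLinearEquiv.refl ℝ ℂ : ℂ ≃L[ℝ] ℂ) : ℂ →L[ℝ] ℂ) z₀ := by
    rw [← hfd]; exact ((hfa z₀ hz₀).differentiableAt (by simp)).hasFDerivAt
  set e := (hfa z₀ hz₀).toOpenPartialHomeomorph f hfd' (by simp) with he
  have hef : ∀ z, e z = f z := fun z => rfl
  have hsrc : z₀ ∈ e.source := (hfa z₀ hz₀).mem_toOpenPartialHomeomorph_source hfd' (by simp)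
  have hinv : ∀ᶠ z in 𝓝 z₀, fderiv ℝ f z ∈ range ((↑) : (ℂ ≃L[ℝ] ℂ) → ℂ →L[ℝ] ℂ) := by
    have h1 : ContinuousAt (fderiv ℝ f) z₀ :=
      (hfs.continuousOn_fderiv_of_isOpen hZ (by simp)).continuousAt (hZ.mem_nhds hz₀)
    refine h1.eventually ?_
    rw [hfd]
    exact ContinuousLinearEquiv.nhds _
  have hsrc' : ∀ᶠ z in 𝓝 z₀, z ∈ e.source := e.open_source.mem_nhds hsrc
  have hZ' : ∀ᶠ z in 𝓝 z₀, z ∈ Z := hZ.mem_nhds hz₀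
  obtain ⟨ε, hε, hB⟩ := Metric.eventually_nhds_iff_ball.1 (hsrc'.and (hZ'.and hinv))
  set B := Metric.ball z₀ (min ε δ) with hBdef
  have hBε : B ⊆ Metric.ball z₀ ε := Metric.ball_subset_ball (min_le_left _ _)
  have hBs : B ⊆ e.source := fun z hz => (hB z (hBε hz)).1
  have hopen : IsOpen (e '' B) := e.isOpen_image_of_subset_source Metric.isOpen_ball hBs
  have hz₀B : z₀ ∈ B := Metric.mem_ball_self (lt_min hε hδ)
  refine ⟨P ⁻¹' (e '' B), fun y => e.symm (P y), hopen.preimage P.continuous, ⟨z₀, hz₀B, rfl⟩,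
    ?_, ?_, ?_⟩
  · intro y hy
    obtain ⟨z, hz, hzy⟩ := hy
    obtain ⟨hz1, hz2, T, hT⟩ := hB z (hBε hz)
    have hes : e.symm (P y) = z := by rw [← hzy, e.left_inv hz1]
    have h1 : ContDiffAt ℝ ∞ e.symm (P y) := by
      refine e.contDiffAt_symm (f₀' := T) ?_ ?_ ?_
      · rw [← hzy]; exact e.map_source hz1
      · rw [hes, hT]
        exact ((hfa z hz2).differentiableAt (by simp)).hasFDerivAt
      · rw [hes]; exact hfa z hz2
    exact (h1.comp y P.contDiff.contDiffAt).contDiffWithinAt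
  · rintro y ⟨z, hz, hzy⟩
    have hes : e.symm (P y) = z := by rw [← hzy, e.left_inv (hBs hz)]
    simp only [hes]
    exact ⟨Metric.ball_subset_ball (min_le_right _ _) hz, (hB z (hBε hz)).2.1⟩
  · filter_upwards [hsrc'] with z hz using e.left_inv hz

/-- A continuous nowhere zero function on an immersed disk that is smooth off the centre extends to
a function with the same properties on a neighbourhood of the centre. -/
theorem exists_extension {u : ℂ → E4} {Z : Set ℂ} (hZ : IsOpen Z) (hu : ContDiffOn ℝ ∞ u Z)
    {z₀ : ℂ} (hz₀ : z₀ ∈ Z) (hinj : Function.Injective (fderiv ℝ u z₀)) {F : ℂ → ℂ} {r : ℝ}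
    (hr : 0 < r) (hF : ContinuousAt F z₀) (hF0 : F z₀ ≠ 0)
    (hFs : ∀ z ∈ Metric.ball z₀ r, z ≠ z₀ → ContDiffAt ℝ ∞ F z) :
    ∃ (S : Set E4) (Φ : E4 → ℂ), IsOpen S ∧ u z₀ ∈ S ∧ ContinuousOn Φ S ∧ (∀ y ∈ S, Φ y ≠ 0) ∧
      ContDiffOn ℝ ∞ Φ (S \ {u z₀}) ∧ ∀ᶠ z in 𝓝 z₀, Φ (u z) = F z := by
  -- With tolerance `‖F z₀‖`, values of `F` stay strictly closer to `F z₀` than zero does; this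
  -- keeps the extension nonvanishing.
  obtain ⟨δ, hδ, hFδ⟩ := Metric.continuousAt_iff.1 hF ‖F z₀‖ (norm_pos_iff.2 hF0)
  obtain ⟨S, ρ, hS, hu0, hρ, hmaps, hρu⟩ := exists_smooth_retraction hZ hu hz₀ hinj
    (lt_min hδ hr)
  -- The pullback `F ∘ ρ` could fail to be smooth on the whole fibre of `ρ` over `z₀`, while only
  -- the point `u z₀` is allowed. The cutoff is `1` on the curve, and `0` where the distance to `u
  -- (ρ y)` is at least `‖ρ y - z₀‖ > 0`, hence near every other point of that fibre off the fibre
  -- itself.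
  set χ : E4 → ℝ := fun y => Real.smoothTransition (1 - ‖y - u (ρ y)‖ ^ 2 / ‖ρ y - z₀‖ ^ 2) with hχ
  have hχ01 : ∀ y, ‖(χ y : ℂ)‖ ≤ 1 := fun y => by
    rw [Complex.norm_real, Real.norm_of_nonneg (Real.smoothTransition.nonneg _)]
    exact Real.smoothTransition.le_one _
  set Φ : E4 → ℂ := fun y => F z₀ + χ y * (F (ρ y) - F z₀) with hΦ
  have hΦle : ∀ y, ‖Φ y - F z₀‖ ≤ ‖F (ρ y) - F z₀‖ := fun y => by
    simp only [hΦ, add_sub_cancel_left, norm_mul]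
    exact mul_le_of_le_one_left (norm_nonneg _) (hχ01 y)
  have hρ0 : ρ (u z₀) = z₀ := hρu.self_of_nhds
  have hsmooth : ∀ y ∈ S, y ≠ u z₀ → ContDiffAt ℝ ∞ Φ y := by
    intro y hy hne
    have hρy : ContDiffAt ℝ ∞ ρ y := hρ.contDiffAt (hS.mem_nhds hy)
    have hw : ContDiffAt ℝ ∞ (fun y => y - u (ρ y)) y :=
      contDiffAt_id.sub ((hu.contDiffAt (hZ.mem_nhds (hmaps hy).2)).comp y hρy)
    by_cases h0 : ρ y = z₀
    · have h1 : ∀ᶠ y' in 𝓝 y, ‖ρ y' - z₀‖ ^ 2 < ‖y' - u (ρ y')‖ ^ 2 := by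
        refine ((hρy.continuousAt.sub continuousAt_const).norm.pow 2).eventually_lt
          (hw.continuousAt.norm.pow 2) ?_
        have : 0 < ‖y - u z₀‖ := norm_pos_iff.2 (sub_ne_zero.2 hne)
        show ‖ρ y - z₀‖ ^ 2 < ‖y - u (ρ y)‖ ^ 2
        rw [h0, sub_self, norm_zero, zero_pow two_ne_zero]
        positivity
      refine (contDiffAt_const (c := F z₀)).congr_of_eventuallyEq ?_
      filter_upwards [h1] with y' hy'
      by_cases h2 : ρ y' = z₀
      · simp [hΦ, h2]
      · have h3 : 0 < ‖ρ y' - z₀‖ ^ 2 := by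
          have : 0 < ‖ρ y' - z₀‖ := norm_pos_iff.2 (sub_ne_zero.2 h2)
          positivity
        have h4 : χ y' = 0 := Real.smoothTransition.zero_of_nonpos (by
          rw [sub_nonpos, le_div_iff₀ h3, one_mul]; exact hy'.le)
        simp [hΦ, h4]
    · have h1 : ContDiffAt ℝ ∞ χ y := by
        refine Real.smoothTransition.contDiffAt.comp y (contDiffAt_const.sub ?_)
        refine (hw.norm_sq ℝ).div ((hρy.sub contDiffAt_const).norm_sq ℝ) ?_
        exact pow_ne_zero 2 (norm_ne_zero_iff.2 (sub_ne_zero.2 h0))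
      have h2 : ContDiffAt ℝ ∞ F (ρ y) :=
        hFs _ (Metric.ball_subset_ball (min_le_right _ _) (hmaps hy).1) h0
      exact contDiffAt_const.add ((Complex.ofRealCLM.contDiff.contDiffAt.comp y h1).mul
        ((h2.comp y hρy).sub contDiffAt_const))
  refine ⟨S, Φ, hS, hu0, fun y hy => ?_, fun y hy h0 => ?_,
    fun y hy => (hsmooth y hy.1 hy.2).contDiffWithinAt, ?_⟩
  · by_cases hne : y = u z₀
    · subst hne
      refine ContinuousAt.continuousWithinAt ?_
      have h1 : Φ (u z₀) = F z₀ := by simp [hΦ, hρ0]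
      rw [ContinuousAt, h1, tendsto_iff_norm_sub_tendsto_zero]
      refine squeeze_zero (fun _ => norm_nonneg _) hΦle ?_
      have h2 : ContinuousAt (fun y => F (ρ y)) (u z₀) :=
        ContinuousAt.comp (by rw [hρ0]; exact hF) (hρ.contDiffAt (hS.mem_nhds hy)).continuousAt
      have h3 := (h2.sub (continuousAt_const (y := F z₀))).norm
      simpa [ContinuousAt, hρ0] using h3
    · exact (hsmooth y hy hne).continuousAt.continuousWithinAt
  · have h1 := hΦle y
    rw [h0, zero_sub, norm_neg] at h1
    have h2 := hFδ (Metric.ball_subset_ball (min_le_left _ _) (hmaps hy).1)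
    rw [dist_eq_norm] at h2
    linarith
  · filter_upwards [hρu] with z hz
    simp [hΦ, hχ, hz]

end Extension

/-! ### Zeros of the form along the disk -/

section ZeroSet

variable {M : Type*} [TopologicalSpace M] [ChartedSpace E4 M] [IsManifold (𝓡 4) ∞ M]

namespace AlmostComplexStructure

variable {J : AlmostComplexStructure M} {u : ℂ → M} {α : TwoForm M}

theorem eq_comb_ofChart {c x : M} (hx : x ∈ (extChartAt (𝓡 4) c).source)
    {η : E4 → E4 [⋀^Fin 2]→L[ℝ] ℝ} {p q : ℝ}
    (h : α.inChart c (extChartAt (𝓡 4) c x) = p • η (extChartAt (𝓡 4) c x) +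
      q • twoFormAct (J.inChart c (extChartAt (𝓡 4) c x)) (η (extChartAt (𝓡 4) c x))) :
    α x = p • TwoForm.ofChart c η x + q • J.act (TwoForm.ofChart c η x) := by
  rw [J.act_ofChart hx, ← TwoForm.ofChart_inChart α hx]
  refine twoForm_ext fun a b => ?_
  simp only [TwoForm.ofChart, ContinuousAlternatingMap.add_apply,
    ContinuousAlternatingMap.smul_apply, compContinuousLinearMap_two, h]

theorem IsFrameOn.comb_eq_zero_iff {φ : TwoForm M} {U : Set M} (h : J.IsFrameOn φ U) {x : M}
    (hx : x ∈ U) {p q : ℝ} : p • φ x + q • J.act (φ x) = 0 ↔ p = 0 ∧ q = 0 := by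
  refine ⟨LinearIndependent.pair_iff.1 (h x hx).1 p q, ?_⟩
  rintro ⟨rfl, rfl⟩
  rw [zero_smul, zero_smul, add_zero]

theorem IsEmbeddedHolomorphicDisk.exists_local_frame (hu : J.IsEmbeddedHolomorphicDisk u)
    (hα : α.IsSmoothOn univ) (hanti : ∀ x, α x ∈ J.antiInvariant x) (hclosed : α.IsClosedForm)
    {z₀ : ℂ} (hz₀ : z₀ ∈ disk) :
    ∃ (V : Set E4) (η : E4 → E4 [⋀^Fin 2]→L[ℝ] ℝ) (q : E4 → ℂ) (r : ℝ) (F σ : ℂ → ℂ), IsOpen V ∧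
      V ⊆ (extChartAt (𝓡 4) (u z₀)).target ∧ extChartAt (𝓡 4) (u z₀) (u z₀) ∈ V ∧
      ContDiffOn ℝ ∞ η V ∧ ContDiffOn ℝ ∞ q V ∧
      (∀ y ∈ V, IsAntiInvariant (J.inChart (u z₀) y) (η y) ∧ η y ≠ 0 ∧
        α.inChart (u z₀) y = (q y).re • η y + (-(q y).im) • twoFormAct (J.inChart (u z₀) y) (η y)) ∧
      0 < r ∧ Metric.ball z₀ r ⊆ disk ∩ u ⁻¹' (extChartAt (𝓡 4) (u z₀)).source ∧
      MapsTo (fun z => extChartAt (𝓡 4) (u z₀) (u z)) (Metric.ball z₀ r) V ∧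
      ContinuousOn F (Metric.ball z₀ r) ∧ (∀ z ∈ Metric.ball z₀ r, F z ≠ 0) ∧
      DifferentiableOn ℂ σ (Metric.ball z₀ r) ∧
      ∀ z ∈ Metric.ball z₀ r, q (extChartAt (𝓡 4) (u z₀) (u z)) = F z * σ z := by
  have hz : z₀ ∈ disk ∩ u ⁻¹' (extChartAt (𝓡 4) (u z₀)).source :=
    ⟨hz₀, mem_extChartAt_source (u z₀)⟩
  refine (hu.holomorphicData hα hanti hclosed (u z₀)).exists_local_frame hz fun h => ?_
  have := hu.injective_fderiv_inChart hz (h.trans (map_zero _).symm)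
  exact one_ne_zero this

/-- In the smooth local frame the complex coefficient along the disk is `F σ` with `F` nonvanishing,
so both the zeros and the index are read off from the holomorphic `σ`. -/
theorem IsEmbeddedHolomorphicDisk.zero_dichotomy (hu : J.IsEmbeddedHolomorphicDisk u)
    (hα : α.IsSmoothOn univ) (hanti : ∀ x, α x ∈ J.antiInvariant x) (hclosed : α.IsClosedForm)
    {z₀ : ℂ} (hz₀ : z₀ ∈ disk) :
    (∀ᶠ z in 𝓝 z₀, α (u z) = 0) ∨ (∀ᶠ z in 𝓝[≠] z₀, α (u z) ≠ 0) ∧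
      (α (u z₀) = 0 → ∃ k : ℤ, 0 < k ∧ HasZeroIndex J α u z₀ k) := by
  obtain ⟨V, η, q, r, F, σ, hV, -, huV, hη, -, hcomb, hr, hball, hmaps, hF, hF0, hσ, hq⟩ :=
    hu.exists_local_frame hα hanti hclosed hz₀
  set c := u z₀ with hc
  set W : Set M := (extChartAt (𝓡 4) c).source ∩ extChartAt (𝓡 4) c ⁻¹' V with hW
  have hWo : IsOpen W := (continuousOn_extChartAt c).isOpen_inter_preimage
    (isOpen_extChartAt_source c) hV
  have hframe : J.IsFrameOn (TwoForm.ofChart c η) W :=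
    J.isFrameOn_ofChart inter_subset_left (fun x hx => (hcomb _ hx.2).1)
      fun x hx => (hcomb _ hx.2).2.1
  have hdecomp : ∀ x ∈ W, α x = (q (extChartAt (𝓡 4) c x)).re • TwoForm.ofChart c η x +
      (-(q (extChartAt (𝓡 4) c x)).im) • J.act (TwoForm.ofChart c η x) := fun x hx =>
    eq_comb_ofChart hx.1 (hcomb _ hx.2).2.2
  have hbW : ∀ z ∈ Metric.ball z₀ r, u z ∈ W := fun z hz => ⟨(hball hz).2, hmaps hz⟩
  have hzero : ∀ z ∈ Metric.ball z₀ r, α (u z) = 0 ↔ σ z = 0 := fun z hz => by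
    have h1 : F z * σ z = 0 ↔ σ z = 0 := by simp [hF0 z hz]
    rw [hdecomp _ (hbW z hz), hframe.comb_eq_zero_iff (hbW z hz), hq z hz, neg_eq_zero, ← h1,
      Complex.ext_iff]
    rfl
  have hmem : z₀ ∈ Metric.ball z₀ r := Metric.mem_ball_self hr
  have hnear : ∀ᶠ z in 𝓝 z₀, z ∈ Metric.ball z₀ r := Metric.ball_mem_nhds z₀ hr
  rcases zeros_of_mul_holomorphic
      (hnear.mono fun z hz => hF.continuousAt (Metric.isOpen_ball.mem_nhds hz)) (hF0 z₀ hmem)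
      (hσ.analyticAt (Metric.ball_mem_nhds z₀ hr)) with h | ⟨h, hind⟩
  · left
    filter_upwards [h, hnear] with z hz hzr using (hzero z hzr).2 hz
  · refine Or.inr ⟨?_, fun h0 => ?_⟩
    · filter_upwards [h, hnear.filter_mono nhdsWithin_le_nhds] with z hz hzr using
        fun h0 => hz ((hzero z hzr).1 h0)
    · obtain ⟨k, hk, hw⟩ := hind ((hzero z₀ hmem).1 h0)
      refine ⟨k, hk, W, TwoForm.ofChart c η, fun x => (q (extChartAt (𝓡 4) c x)).re,
        fun x => -(q (extChartAt (𝓡 4) c x)).im, hWo, hbW z₀ hmem,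
        TwoForm.isContinuousOn_ofChart inter_subset_left hη.continuousOn fun x hx => hx.2,
        hframe, hdecomp, ?_⟩
      refine hw (fun z => ((q (extChartAt (𝓡 4) c (u z))).re : ℂ) -
        Complex.I * ((-(q (extChartAt (𝓡 4) c (u z))).im : ℝ) : ℂ)) ?_
      filter_upwards [hnear] with z hz
      rw [← hq z hz]
      apply Complex.ext <;> simp

/-- The points near which `α ∘ u` vanishes identically and those with a zero-free punctured
neighbourhood form two disjoint open sets. They cover the connected disk, so one of them contains
it. -/
theorem IsEmbeddedHolomorphicDisk.zero_alternative (hu : J.IsEmbeddedHolomorphicDisk u)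
    (hα : α.IsSmoothOn univ) (hanti : ∀ x, α x ∈ J.antiInvariant x) (hclosed : α.IsClosedForm) :
    (∀ z ∈ disk, α (u z) = 0) ∨ ∀ z ∈ disk, (∀ᶠ w in 𝓝[≠] z, α (u w) ≠ 0) ∧
      (α (u z) = 0 → ∃ k : ℤ, 0 < k ∧ HasZeroIndex J α u z k) := by
  have hpre : IsPreconnected disk := (convex_ball (0 : ℂ) 1).isPreconnected
  have hdich := fun z (hz : z ∈ disk) => hu.zero_dichotomy hα hanti hclosed hz
  set P : Set ℂ := {z | ∀ᶠ w in 𝓝 z, α (u w) = 0} with hP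
  set N : Set ℂ := {z | ∀ᶠ w in 𝓝[≠] z, α (u w) ≠ 0} with hN
  have hdisj : Disjoint P N := disjoint_left.2 fun z hz hz' => by
    obtain ⟨w, h1, h2⟩ := ((hz.filter_mono nhdsWithin_le_nhds).and hz').exists
    exact h2 h1
  have hNo : IsOpen N := by
    refine isOpen_iff_mem_nhds.2 fun z hz => ?_
    have h1 : ∀ᶠ w in 𝓝 z, w ≠ z → α (u w) ≠ 0 := eventually_nhdsWithin_iff.1 hz
    filter_upwards [h1.eventually_nhds] with w hw
    by_cases hwz : w = z
    · rw [hwz]; exact hz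
    · refine Filter.Eventually.filter_mono nhdsWithin_le_nhds ?_
      filter_upwards [hw, isOpen_ne.mem_nhds hwz] with x hx hxz using hx hxz
  rcases hpre.subset_or_subset isOpen_setOfPred_eventually_nhds hNo hdisj
    fun z hz => (hdich z hz).imp id And.left with h | h
  · exact Or.inl fun z hz => (h hz).self_of_nhds
  · refine Or.inr fun z hz => (hdich z hz).resolve_left fun h0 => ?_
    exact disjoint_left.1 hdisj h0 (h hz)

end AlmostComplexStructure

end ZeroSet

/-! ### The frame with holomorphic coefficient -/

section HolomorphicFrame

variable {M : Type*} [TopologicalSpace M] [ChartedSpace E4 M] [IsManifold (𝓡 4) ∞ M]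

namespace AlmostComplexStructure

variable {J : AlmostComplexStructure M} {u : ℂ → M} {α : TwoForm M}

/-- The coefficient of a section of a complex line bundle along a curve, divided by a nowhere zero
function on the ambient space, becomes holomorphic near the centre. -/
theorem IsEmbeddedHolomorphicDisk.exists_quotient_holomorphic
    (hu : J.IsEmbeddedHolomorphicDisk u) {c : M} {z₀ : ℂ} {V : Set E4} {q : E4 → ℂ} {r : ℝ}
    {F σ : ℂ → ℂ} (hz₀ : z₀ ∈ disk ∩ u ⁻¹' (extChartAt (𝓡 4) c).source)
    (hq : ContDiffOn ℝ ∞ q V)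
    (hr : 0 < r) (hball : Metric.ball z₀ r ⊆ disk ∩ u ⁻¹' (extChartAt (𝓡 4) c).source)
    (hmaps : MapsTo (fun z => extChartAt (𝓡 4) c (u z)) (Metric.ball z₀ r) V)
    (hucs : ContDiffOn ℝ ∞ (fun z => extChartAt (𝓡 4) c (u z))
      (disk ∩ u ⁻¹' (extChartAt (𝓡 4) c).source))
    (hF : ContinuousOn F (Metric.ball z₀ r)) (hF0 : ∀ z ∈ Metric.ball z₀ r, F z ≠ 0)
    (hσ : DifferentiableOn ℂ σ (Metric.ball z₀ r))
    (hqF : ∀ z ∈ Metric.ball z₀ r, q (extChartAt (𝓡 4) c (u z)) = F z * σ z) :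
    ∃ (S : Set E4) (Φ : E4 → ℂ) (s : ℝ), IsOpen S ∧ extChartAt (𝓡 4) c (u z₀) ∈ S ∧
      ContinuousOn Φ S ∧ (∀ y ∈ S, Φ y ≠ 0) ∧
      ContDiffOn ℝ ∞ Φ (S \ {extChartAt (𝓡 4) c (u z₀)}) ∧ 0 < s ∧
      DifferentiableOn ℂ (fun z => q (extChartAt (𝓡 4) c (u z)) * (Φ (extChartAt (𝓡 4) c (u z)))⁻¹)
        (Metric.ball z₀ s) := by
  have hnear : ∀ᶠ z in 𝓝 z₀, z ∈ Metric.ball z₀ r := Metric.ball_mem_nhds z₀ hr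
  have hmem : z₀ ∈ Metric.ball z₀ r := Metric.mem_ball_self hr
  rcases (hσ.analyticAt (Metric.ball_mem_nhds z₀ hr)).eventually_eq_zero_or_eventually_ne_zero
    with h | h
  -- If `σ` vanishes identically, so does the coefficient near the centre, and no correction of the
  -- frame is needed.
  · obtain ⟨s, hs, hB⟩ := Metric.eventually_nhds_iff_ball.1 (h.and hnear)
    refine ⟨univ, fun _ => 1, s, isOpen_univ, mem_univ _, continuousOn_const,
      fun _ _ => one_ne_zero, contDiffOn_const, hs, ?_⟩
    refine (differentiableOn_const (0 : ℂ)).congr fun z hz => ?_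
    rw [hqF z (hB z hz).2, (hB z hz).1, mul_zero, zero_mul]
  · obtain ⟨s, hs, hB⟩ := Metric.eventually_nhds_iff_ball.1
      ((eventually_nhdsWithin_iff.1 h).and hnear)
    have hσs : ∀ z ∈ Metric.ball z₀ r, ContDiffAt ℝ ∞ σ z := fun z hz =>
      ((hσ.analyticAt (Metric.isOpen_ball.mem_nhds hz)).contDiffAt (n := ∞)).restrict_scalars ℝ
    -- Off the centre `σ` has no zeros, so `F` is the quotient of the smooth `q ∘ u` by `σ` and
    -- inherits smoothness there.
    have hFs : ∀ z ∈ Metric.ball z₀ s, z ≠ z₀ → ContDiffAt ℝ ∞ F z := fun z hz hne => by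
      have hzr := (hB z hz).2
      have h1 : ContDiffAt ℝ ∞ (fun z => q (extChartAt (𝓡 4) c (u z)) * (σ z)⁻¹) z := by
        refine ContDiffAt.mul ?_ ((hσs z hzr).inv ((hB z hz).1 hne))
        exact (hq.comp (hucs.mono hball) hmaps).contDiffAt (Metric.isOpen_ball.mem_nhds hzr)
      refine h1.congr_of_eventuallyEq ?_
      filter_upwards [Metric.isOpen_ball.mem_nhds hz, isOpen_ne.mem_nhds hne] with w hw hwne
      rw [hqF w (hB w hw).2, mul_inv_cancel_right₀ ((hB w hw).1 hwne)]
    obtain ⟨S, Φ, hS, huS, hΦ, hΦ0, hΦs, hΦF⟩ := exists_extension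
      (hu.isOpen_preimage (isOpen_extChartAt_source c)) hucs hz₀
      (hu.injective_fderiv_inChart hz₀) hs
      (hF.continuousAt (Metric.isOpen_ball.mem_nhds hmem)) (hF0 z₀ hmem) hFs
    obtain ⟨t, ht, hC⟩ := Metric.eventually_nhds_iff_ball.1 (hΦF.and hnear)
    refine ⟨S, Φ, t, hS, huS, hΦ, hΦ0, hΦs, ht, ?_⟩
    refine (hσ.mono fun z hz => (hC z hz).2).congr fun z hz => ?_
    rw [(hC z hz).1, hqF z (hC z hz).2, mul_comm (F z), mul_inv_cancel_right₀ (hF0 z (hC z hz).2)]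

theorem IsEmbeddedHolomorphicDisk.exists_holomorphic_frame (hu : J.IsEmbeddedHolomorphicDisk u)
    (hα : α.IsSmoothOn univ) (hanti : ∀ x, α x ∈ J.antiInvariant x) (hclosed : α.IsClosedForm) :
    ∃ (U : Set M) (φ : TwoForm M) (f g : M → ℝ), IsOpen U ∧ u 0 ∈ U ∧
      φ.IsContinuousOn U ∧ φ.IsSmoothOn (U \ {u 0}) ∧ J.IsFrameOn φ U ∧
      ContinuousOn f U ∧ ContinuousOn g U ∧
      ContMDiffOn (𝓡 4) 𝓘(ℝ, ℝ) ∞ f (U \ {u 0}) ∧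
      ContMDiffOn (𝓡 4) 𝓘(ℝ, ℝ) ∞ g (U \ {u 0}) ∧
      (∀ x ∈ U, α x = f x • φ x + g x • J.act (φ x)) ∧
      DifferentiableOn ℂ (fun z => (f (u z) : ℂ) - Complex.I * (g (u z) : ℂ))
        (disk ∩ u ⁻¹' U) := by
  have h0 : (0 : ℂ) ∈ disk := Metric.mem_ball_self one_pos
  obtain ⟨V, η, q, r, F, σ, hV, hVT, huV, hη, hqs, hcomb, hr, hball, hmaps, hF, hF0, hσ, hqF⟩ :=
    hu.exists_local_frame hα hanti hclosed h0
  set c := u 0 with hc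
  have hcs : c ∈ (extChartAt (𝓡 4) c).source := mem_extChartAt_source c
  obtain ⟨S, Φ, s, hS, huS, hΦ, hΦ0, hΦs, hs, hquot⟩ := hu.exists_quotient_holomorphic ⟨h0, hcs⟩
    hqs hr hball hmaps (hu.holomorphicData hα hanti hclosed c).contDiffOn_curve hF hF0 hσ hqF
  obtain ⟨O, hO, huO, hOs⟩ := hu.exists_preimage_subset_ball hs
  set φc := extChartAt (𝓡 4) c with hφc
  set U : Set M := (φc.source ∩ φc ⁻¹' (V ∩ S)) ∩ O with hU
  have hUs : U ⊆ φc.source := fun x hx => hx.1.1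
  have hUV : MapsTo φc U (V ∩ S) := fun x hx => hx.1.2
  have hUV' : MapsTo φc (U \ {c}) ((V ∩ S) \ {φc c}) := fun x hx =>
    ⟨hUV hx.1, fun h => hx.2 (φc.injOn (hUs hx.1) hcs h)⟩
  -- This is `Φ` times `η` in the complex line of forms, with `i` acting as `-J`. The coefficient of
  -- `α` accordingly becomes `κ = q / Φ`, so `f = Re κ`, `g = -Im κ` and `f - i g = κ`.
  set ζ : E4 → E4 [⋀^Fin 2]→L[ℝ] ℝ := fun y =>
    (Φ y).re • η y + (-(Φ y).im) • twoFormAct (J.inChart c y) (η y) with hζ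
  have hJη : ContDiffOn ℝ ∞ (fun y => twoFormAct (J.inChart c y) (η y)) V :=
    ((J.contDiffOn_inChart c).mono hVT).twoFormAct hη
  have hζc : ContinuousOn ζ (V ∩ S) :=
    ((Complex.continuous_re.comp_continuousOn (hΦ.mono inter_subset_right)).smul
      (hη.continuousOn.mono inter_subset_left)).add
    ((Complex.continuous_im.comp_continuousOn (hΦ.mono inter_subset_right)).neg.smul
      (hJη.continuousOn.mono inter_subset_left))
  have hSV : (V ∩ S) \ {φc c} ⊆ S \ {φc c} := sdiff_subset_sdiff_left inter_subset_right
  have hVV : (V ∩ S) \ {φc c} ⊆ V := sdiff_subset.trans inter_subset_left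
  have hζs : ContDiffOn ℝ ∞ ζ ((V ∩ S) \ {φc c}) :=
    ((Complex.reCLM.contDiff.comp_contDiffOn (hΦs.mono hSV)).smul (hη.mono hVV)).add
    ((Complex.imCLM.contDiff.comp_contDiffOn (hΦs.mono hSV)).neg.smul (hJη.mono hVV))
  have hsq : ∀ y ∈ V, ∀ v, J.inChart c y (J.inChart c y v) = -v := fun y hy => J.inChart_sq (hVT hy)
  have hζa : ∀ y ∈ V, IsAntiInvariant (J.inChart c y) (ζ y) := fun y hy =>
    (hcomb y hy).1.comb (hsq y hy) _ _
  have hζ0 : ∀ y ∈ V ∩ S, ζ y ≠ 0 := fun y hy h => hΦ0 y hy.2 <| by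
    obtain ⟨h1, h2⟩ := LinearIndependent.pair_iff.1
      (linearIndependent_twoFormAct (hsq y hy.1) (hcomb y hy.1).1 (hcomb y hy.1).2.1) _ _ h
    exact Complex.ext h1 (neg_eq_zero.1 h2)
  set κ : E4 → ℂ := fun y => q y * (Φ y)⁻¹ with hκ
  have hκc : ContinuousOn κ (V ∩ S) := (hqs.continuousOn.mono inter_subset_left).mul
    ((hΦ.mono inter_subset_right).inv₀ fun y hy => hΦ0 y hy.2)
  have hκs : ContDiffOn ℝ ∞ κ ((V ∩ S) \ {φc c}) :=
    (hqs.mono hVV).mul ((hΦs.mono hSV).inv fun y hy => hΦ0 y hy.1.2)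
  have hAκ : ∀ y ∈ V ∩ S, α.inChart c y =
      (κ y).re • ζ y + (-(κ y).im) • twoFormAct (J.inChart c y) (ζ y) := fun y hy => by
    have hqy : q y = κ y * Φ y := (inv_mul_cancel_right₀ (hΦ0 y hy.2) (q y)).symm
    generalize κ y = k at hqy ⊢
    rw [(hcomb y hy.1).2.2, twoFormAct_comb (hsq y hy.1) (hcomb y hy.1).1, hqy, Complex.mul_re,
      Complex.mul_im]
    module
  have hcont : ContinuousOn φc U := (continuousOn_extChartAt c).mono hUs
  have hsm : ContMDiffOn (𝓡 4) 𝓘(ℝ, E4) ∞ φc (U \ {c}) :=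
    (contMDiffOn_extChartAt (I := 𝓡 4) (n := ∞) (x := c)).mono fun x hx => by
      rw [← extChartAt_source (𝓡 4)]; exact hUs hx.1
  refine ⟨U, TwoForm.ofChart c ζ, fun x => (κ (φc x)).re, fun x => -(κ (φc x)).im, ?_,
    ⟨⟨hcs, huV, huS⟩, huO⟩, TwoForm.isContinuousOn_ofChart hUs hζc hUV,
    TwoForm.isSmoothOn_ofChart (sdiff_subset.trans hUs) hζs hUV',
    J.isFrameOn_ofChart hUs (fun x hx => hζa _ (hUV hx).1) fun x hx => hζ0 _ (hUV hx),
    Complex.continuous_re.comp_continuousOn (hκc.comp hcont hUV),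
    (Complex.continuous_im.comp_continuousOn (hκc.comp hcont hUV)).neg,
    (Complex.reCLM.contDiff.comp_contDiffOn hκs).contMDiffOn.comp hsm hUV',
    (Complex.imCLM.contDiff.comp_contDiffOn hκs).neg.contMDiffOn.comp hsm hUV',
    fun x hx => eq_comb_ofChart (hUs hx) (hAκ _ (hUV hx)), ?_⟩
  · exact ((continuousOn_extChartAt c).isOpen_inter_preimage (isOpen_extChartAt_source c)
      (hV.inter hS)).inter hO
  · refine (hquot.mono fun z hz => hOs ⟨hz.1, hz.2.2⟩).congr fun z hz => ?_
    show ((κ (φc (u z))).re : ℂ) - Complex.I * ((-(κ (φc (u z))).im : ℝ) : ℂ) = κ (φc (u z))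
    apply Complex.ext <;> simp

end AlmostComplexStructure

end HolomorphicFrame

theorem lemma2p3 {M : Type*} [TopologicalSpace M] [T2Space M] [SecondCountableTopology M]
    [ChartedSpace E4 M] [IsManifold (𝓡 4) ∞ M]
    (J : AlmostComplexStructure M) (u : ℂ → M) (hu : J.IsEmbeddedHolomorphicDisk u)
    (α : TwoForm M) (hα : α.IsSmoothOn univ) (hanti : ∀ x, α x ∈ J.antiInvariant x)
    (hclosed : α.IsClosedForm) :
    (∃ (U : Set M) (φ : TwoForm M) (f g : M → ℝ), IsOpen U ∧ u 0 ∈ U ∧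
      φ.IsContinuousOn U ∧ φ.IsSmoothOn (U \ {u 0}) ∧ J.IsFrameOn φ U ∧
      ContinuousOn f U ∧ ContinuousOn g U ∧
      ContMDiffOn (𝓡 4) 𝓘(ℝ, ℝ) ∞ f (U \ {u 0}) ∧
      ContMDiffOn (𝓡 4) 𝓘(ℝ, ℝ) ∞ g (U \ {u 0}) ∧
      (∀ x ∈ U, α x = f x • φ x + g x • J.act (φ x)) ∧
      DifferentiableOn ℂ (fun z => (f (u z) : ℂ) - Complex.I * (g (u z) : ℂ))
        (AlmostComplexStructure.disk ∩ u ⁻¹' U)) ∧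
    ((∀ z ∈ AlmostComplexStructure.disk, α (u z) = 0) ∨
      ∀ z ∈ AlmostComplexStructure.disk,
        (∀ᶠ w in 𝓝[≠] z, α (u w) ≠ 0) ∧
        (α (u z) = 0 → ∃ k : ℤ, 0 < k ∧ HasZeroIndex J α u z k)) :=
  ⟨hu.exists_holomorphic_frame hα hanti hclosed, hu.zero_alternative hα hanti hclosed⟩
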